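/- **Setting.** $ZFC^-$ is $ZFC$ without the powerset axiom, with collection in place of replacement and with the well-ordering principle (every set can be well-ordered) in place of choice. Let $V \models ZFC^-$ be transitive and let $\mathbf{j}: V \preceq \hat V$ be an elementary embedding into a structure $(\hat V, \hat\in)$. Call $\hat V$ *$\omega$-nonstandard* if some natural number of $\hat V$ has infinitely many $\hat\in$-predecessors. A set $X \subseteq \hat V$ is *pseudofinite* if there is $\hat X \in \hat V$, finite in the sense of $\hat V$, with $x \mathrel{\hat\in} \hat X$ for all $x \in X$. Theories and structures are sets; a countable theory comes equipped with an injection of its symbols into $\omega$ (so that if it belongs to $V$, it is countable in $V$). If $M \in V$ is an $\mathcal L$-structure, $\mathbf{j}_{\mathrm{std}}(M)$ is the $\mathcal L$-structure with domain $\{a \in \hat V : a \mathrel{\hat\in} \mathbf{j}(\mathrm{dom}\, M)\}$ in which each symbol $s$ of $\mathcal L$ is interpreted through $\mathbf{j}(s^M)$. For a cardinal $\kappa$, $\mathbf{j}_{\mathrm{std}}(M)$ is *$\kappa$-pseudosaturated* if for every pseudofinite $A \subseteq \mathbf{j}_{\mathrm{std}}(M)$ with $|A| < \kappa$ and every $n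 < \omega$, every complete type $p \in S^n(A)$ is realized in $\mathbf{j}_{\mathrm{std}}(M)$; it is *$\kappa$-saturated* if the same holds for all $A \subseteq \mathbf{j}_{\mathrm{std}}(M)$ with $|A| < \kappa$. For $\lambda$ infinite, an ultrafilter $\mathcal U$ on $\mathcal P(\lambda)$ is *$\lambda$-regular* if there is a family of $\lambda$ many elements of $\mathcal U$ such that the intersection of every infinite subfamily is empty. **Theorem.** Let $T$ be a complete countable theory. 1. Suppose $V \models ZFC^-$ is transitive, $\mathbf{j}: V \preceq \hat V$ is $\omega$-nonstandard, $T \in V$, and $M_0, M_1 \in V$ are models of $T$. Let $\kappa$ be an uncountable cardinal. Then $\mathbf{j}_{\mathrm{std}}(M_0)$ is $\kappa$-pseudosaturated if and only if $\mathbf{j}_{\mathrm{std}}(M_1)$ is. Hence, if every subset of $\hat V$ of size less than $\kappa$ is pseudofinite, then $\mathbf{j}_{\mathrm{std}}(M_0)$ is $\kappa$-saturated if and only if $\mathbf{j}_{\mathrm{std}}(M_1)$ is. 2. Let $V, T, M_0, M_1$ be as in 1, let $\lambda$ be an infinite cardinal, let $\mathcal U$ be a $\lambda$-regular ultrafilter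 on $\mathcal P(\lambda)$, and let $\mathbf{j}: V \preceq V^\lambda/\mathcal U$ be the Łoś embedding. Then $V^\lambda/\mathcal U$ is $\omega$-nonstandard and each of its subsets of size at most $\lambda$ is pseudofinite; consequently $\mathbf{j}_{\mathrm{std}}(M_0)$ is $\lambda^+$-saturated if and only if $\mathbf{j}_{\mathrm{std}}(M_1)$ is. 3. (Keisler) If $M_0, M_1 \models T$, $\lambda$ is an infinite cardinal and $\mathcal U$ is a $\lambda$-regular ultrafilter on $\mathcal P(\lambda)$, then $M_0^\lambda/\mathcal U$ is $\lambda^+$-saturated if and only if $M_1^\lambda/\mathcal U$ is. -/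

import Mathlib

universe u v w x y a b

open FirstOrder FirstOrder.Language Cardinal

namespace Pseudosat

/-! ### The language of set theory and models of `ZFC⁻` -/

/-- The only symbol of the language of set theory: a binary relation. -/
inductive SetRel : ℕ → Type
  | mem : SetRel 2

/-- The language of set theory. -/
def setLang : FirstOrder.Language.{0, 0} := ⟨fun _ => Empty, SetRel⟩

/-- The membership symbol. -/
abbrev memSym : setLang.Relations 2 := SetRel.mem

section Internal

variable {A : Type w} [setLang.Structure A]

/-- The membership relation of a structure for the language of set theory. -/
def E (s t : A) : Prop := Structure.RelMap memSym ![s, t]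

/-- `p` is the Kuratowski pair `{{s}, {s, t}}` in the sense of the structure. -/
def IsPair (s t p : A) : Prop :=
  ∀ z, E z p ↔ (∀ r, E r z ↔ r = s) ∨ (∀ r, E r z ↔ r = s ∨ r = t)

/-- `z` is, in the sense of the structure, the tuple with entries `f 0, …, f (n - 1)`:
the empty tuple is `∅`, and the other tuples are iterated Kuratowski pairs ending in `∅`. -/
def IsTuple : {n : ℕ} → (Fin n → A) → A → Prop
  | 0, _, z => ∀ r, ¬ E r z
  | _ + 1, f, z => ∃ t, IsTuple (Fin.tail f) t ∧ IsPair (f 0) t z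

/-- `s` contains the empty set and is closed under `n ↦ n ∪ {n}`. -/
def IsInductiveSet (s : A) : Prop :=
  (∃ e, E e s ∧ ∀ r, ¬ E r e) ∧
    ∀ n, E n s → ∃ m, E m s ∧ ∀ r, E r m ↔ E r n ∨ r = n

/-- `n` is a natural number in the sense of the structure. -/
def IsNatural (n : A) : Prop := ∀ s, IsInductiveSet s → E n s

/-- The pair `(s, t)` belongs to `r`. -/
def Related (r s t : A) : Prop := ∃ p, IsPair s t p ∧ E p r

/-- `f` is (the graph of) a bijection from `s` to `t`, in the sense of the structure. -/
def IsBijection (f s t : A) : Prop :=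
  (∀ p, E p f → ∃ c d, E c s ∧ E d t ∧ IsPair c d p) ∧
    (∀ c, E c s → ∃! d, Related f c d) ∧
    (∀ d, E d t → ∃! c, Related f c d)

/-- `s` is finite in the sense of the structure. -/
def IsInternallyFinite (s : A) : Prop := ∃ n f, IsNatural n ∧ IsBijection f n s

/-- `r` well-orders `s`, in the sense of the structure. -/
def IsWellOrderOn (r s : A) : Prop :=
  (∀ c, E c s → ¬ Related r c c) ∧
    (∀ c d e, E c s → E d s → E e s → Related r c d → Related r d e → Related r c e) ∧
    (∀ c d, E c s → E d s → Related r c d ∨ c = d ∨ Related r d c) ∧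
    (∀ t, (∃ c, E c t) → (∀ c, E c t → E c s) →
      ∃ m, E m t ∧ ∀ c, E c t → m = c ∨ Related r m c)

end Internal

/-- `A ⊨ ZFC⁻`: the axioms of `ZFC` without powerset, with collection in place of replacement, and
with the well-ordering principle in place of choice. In the two schemes, `φ` is any formula of the
language of set theory, with parameters `e`. -/
structure ModelsZFCMinus (A : Type w) [setLang.Structure A] : Prop where
  extensionality : ∀ s t : A, (∀ r, E r s ↔ E r t) → s = t
  foundation : ∀ s : A, (∃ r, E r s) → ∃ m, E m s ∧ ∀ r, E r m → ¬ E r s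
  pairing : ∀ s t : A, ∃ p : A, ∀ r, E r p ↔ r = s ∨ r = t
  union : ∀ s : A, ∃ t : A, ∀ r, E r t ↔ ∃ q, E q s ∧ E r q
  infinity : ∃ s : A, IsInductiveSet s
  separation : ∀ (φ : setLang.BoundedFormula ℕ 1) (e : ℕ → A) (s : A),
    ∃ t : A, ∀ r, E r t ↔ E r s ∧ φ.Realize e ![r]
  collection : ∀ (φ : setLang.BoundedFormula ℕ 2) (e : ℕ → A) (s : A),
    (∀ r, E r s → ∃ q, φ.Realize e ![r, q]) →
      ∃ t : A, ∀ r, E r s → ∃ q, E q t ∧ φ.Realize e ![r, q]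
  wellOrdering : ∀ s : A, ∃ r : A, IsWellOrderOn r s

theorem ModelsZFCMinus.nonempty {A : Type w} [setLang.Structure A] (h : ModelsZFCMinus A) :
    Nonempty A := h.infinity.nonempty

section Nonstandard

variable (W : Type w) [setLang.Structure W]

/-- `W` has a natural number with infinitely many predecessors. -/
def IsOmegaNonstandard : Prop := ∃ n : W, IsNatural n ∧ {r : W | E r n}.Infinite

variable {W}

/-- `X` is covered by an element of `W` which is finite in the sense of `W`. -/
def IsPseudofinite (X : Set W) : Prop :=
  ∃ s : W, IsInternallyFinite s ∧ ∀ r ∈ X, E r s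

end Nonstandard

/-- A collection of sets, as a structure with the true membership relation. -/
instance instStructureZFSet (V : Set ZFSet.{u}) : setLang.Structure V where
  funMap := fun f => Empty.elim f
  RelMap := fun R => match R with
    | SetRel.mem => fun t => (t 0 : ZFSet.{u}) ∈ (t 1 : ZFSet.{u})

/-- `V` is transitive. -/
def IsTransitiveClass (V : Set ZFSet.{u}) : Prop := ∀ s ∈ V, ∀ t ∈ s, t ∈ V

theorem E_iff {V : Set ZFSet.{u}} (s t : V) : E s t ↔ (s : ZFSet.{u}) ∈ (t : ZFSet.{u}) := Iff.rfl

/-! ### Countable theories and their models as sets -/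

/-- The von Neumann numeral `n`. -/
def numeral : ℕ → ZFSet.{u}
  | 0 => ∅
  | n + 1 => insert (numeral n) (numeral n)

/-- The set coding the tuple `f 0, …, f (n - 1)`: iterated Kuratowski pairs ending in `∅`. -/
def tuple : {n : ℕ} → (Fin n → ZFSet.{u}) → ZFSet.{u}
  | 0, _ => ∅
  | _ + 1, f => ZFSet.pair (f 0) (tuple (Fin.tail f))

/-- The data making a language a countable language in the set-theoretic universe: each symbol is
a set, and the language comes with an injection of its symbols into `ω`. -/
structure SymbolCoding (L : FirstOrder.Language.{a, b}) where
  /-- The set which is the given symbol. -/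
  code : L.Symbols → ZFSet.{u}
  code_injective : Function.Injective code
  /-- The injection of the symbols into `ω`. -/
  index : L.Symbols → ℕ
  index_injective : Function.Injective index

namespace SymbolCoding

theorem countable {L : FirstOrder.Language.{a, b}} (c : SymbolCoding.{u} L) :
    Countable L.Symbols := c.index_injective.countable

variable {L : FirstOrder.Language.{a, b}} (c : SymbolCoding.{u} L)

/-- The signature as a set: for each symbol, the symbol together with its kind (`0` for function
symbols, `1` for relation symbols), its arity, and its index in `ω`. -/
noncomputable def languageCode : ZFSet.{u} :=
  haveI := c.countable
  ZFSet.range fun s : L.Symbols =>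
    tuple ![c.code s, numeral (Sum.elim (fun _ => 0) (fun _ => 1) s),
      numeral (Sum.elim Sigma.fst Sigma.fst s), numeral (c.index s)]

/-- Terms as sets. -/
noncomputable def termCode {n : ℕ} : L.Term (Empty ⊕ Fin n) → ZFSet.{u}
  | .var (.inl e) => e.elim
  | .var (.inr i) => ZFSet.pair (numeral 0) (numeral i)
  | .func f ts => ZFSet.pair (numeral 1)
      (ZFSet.pair (c.code (.inl ⟨_, f⟩)) (tuple fun i => termCode (ts i)))

/-- Formulas (with all variables among the `n` bound ones) as sets. -/
noncomputable def formulaCode : {n : ℕ} → L.BoundedFormula Empty n → ZFSet.{u}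
  | _, .falsum => ZFSet.pair (numeral 0) ∅
  | _, .equal t₁ t₂ => ZFSet.pair (numeral 1) (ZFSet.pair (c.termCode t₁) (c.termCode t₂))
  | _, .rel R ts => ZFSet.pair (numeral 2)
      (ZFSet.pair (c.code (.inr ⟨_, R⟩)) (tuple fun i => c.termCode (ts i)))
  | _, .imp φ ψ => ZFSet.pair (numeral 3) (ZFSet.pair (formulaCode φ) (formulaCode ψ))
  | _, .all φ => ZFSet.pair (numeral 4) (formulaCode φ)

/-- The theory `T` as a set: its signature (with the injection of the symbols into `ω`) together
with the set of its sentences. -/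
noncomputable def theoryCode (T : L.Theory) : ZFSet.{u} :=
  haveI := c.countable
  haveI : Countable L.Sentence := inferInstanceAs (Countable (L.Formula Empty))
  ZFSet.pair c.languageCode (ZFSet.range fun φ : T => c.formulaCode (n := 0) φ.1)

variable (D : ZFSet.{u}) [L.Structure D]

/-- The interpretation of a symbol in a structure with domain `D`, as a set: the graph of a
function, or the set of the tuples in a relation. -/
noncomputable def interpCode : L.Symbols → ZFSet.{u}
  | .inl ⟨n, f⟩ => ZFSet.range fun t : Fin n → D =>
      ZFSet.pair (tuple fun i => (t i : ZFSet.{u})) (Structure.funMap f t : D)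
  | .inr ⟨n, R⟩ => ZFSet.range fun t : {t : Fin n → D // Structure.RelMap R t} =>
      tuple fun i => (t.1 i : ZFSet.{u})

/-- A structure with domain `D` as a set: the pair of `D` and the function which sends each
symbol to its interpretation. -/
noncomputable def structureCode : ZFSet.{u} :=
  haveI := c.countable
  ZFSet.pair D (ZFSet.range fun s : L.Symbols => ZFSet.pair (c.code s) (interpCode D s))

theorem snd_mem_of_pair {V : Set ZFSet.{u}} (hV : IsTransitiveClass V) {s t : ZFSet.{u}}
    (h : ZFSet.pair s t ∈ V) : t ∈ V :=
  hV {s, t} (hV _ h _ (by simp [ZFSet.pair])) _ (by simp)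

theorem fst_mem_of_pair {V : Set ZFSet.{u}} (hV : IsTransitiveClass V) {s t : ZFSet.{u}}
    (h : ZFSet.pair s t ∈ V) : s ∈ V :=
  hV {s, t} (hV _ h _ (by simp [ZFSet.pair])) _ (by simp)

variable {D}

theorem domain_mem {V : Set ZFSet.{u}} (hV : IsTransitiveClass V)
    (hM : c.structureCode D ∈ V) : D ∈ V := fst_mem_of_pair hV hM

theorem interpCode_mem {V : Set ZFSet.{u}} (hV : IsTransitiveClass V)
    (hM : c.structureCode D ∈ V) (s : L.Symbols) : interpCode D s ∈ V := by
  have := c.countable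
  exact snd_mem_of_pair hV (hV _ (snd_mem_of_pair hV hM) (ZFSet.pair (c.code s) (interpCode D s))
    (ZFSet.mem_range.2 ⟨s, rfl⟩))

end SymbolCoding

/-! ### Formulas needed to transfer the totality of functions -/

section Transfer

variable {α : Type}

/-- The formula `s ∈ t`. -/
def memF (s t : α) : setLang.Formula α := Relations.formula₂ memSym (.var s) (.var t)

/-- Existential quantification over the extra variable `none`. -/
def exF (φ : setLang.Formula (Option α)) : setLang.Formula α :=
  (BoundedFormula.relabel (n := 1) (k := 0)
    (fun o : Option α => o.elim (Sum.inr 0) Sum.inl) φ).ex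

/-- Universal quantification over the extra variable `none`. -/
def allF (φ : setLang.Formula (Option α)) : setLang.Formula α := (exF φ.not).not

/-- The formula saying that `p` is the pair `(s, t)`. -/
def pairF (s t p : α) : setLang.Formula α :=
  allF ((memF none (some p)).iff
    ((allF ((memF none (some none)).iff (Term.equal (.var none) (.var (some (some s)))))) ⊔
      (allF ((memF none (some none)).iff
        ((Term.equal (.var none) (.var (some (some s)))) ⊔
          (Term.equal (.var none) (.var (some (some t)))))))))

/-- The formula saying that `z` is the tuple with entries `f 0, …, f (n - 1)`. -/
def tupleF : {n : ℕ} → {α : Type} → (Fin n → α) → α → setLang.Formula α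
  | 0, _, _, z => allF (memF none (some z)).not
  | _ + 1, _, f, z => exF (tupleF (fun i => some (Fin.tail f i)) none ⊓
      pairF (some (f 0)) none (some z))

variable {A : Type w} [setLang.Structure A]

@[simp]
theorem realize_memF {s t : α} {e : α → A} : (memF s t).Realize e ↔ E (e s) (e t) := by
  simp [memF, E]

@[simp]
theorem realize_exF {φ : setLang.Formula (Option α)} {e : α → A} :
    (exF φ).Realize e ↔ ∃ r, φ.Realize (fun o => o.elim r e) := by
  unfold exF Formula.Realize
  rw [BoundedFormula.realize_ex]
  refine exists_congr fun r => ?_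
  rw [BoundedFormula.realize_relabel]
  refine iff_of_eq (congr (congrArg _ ?_) (Subsingleton.elim _ _))
  funext o
  cases o <;> simp [Fin.snoc]

@[simp]
theorem realize_allF {φ : setLang.Formula (Option α)} {e : α → A} :
    (allF φ).Realize e ↔ ∀ r, φ.Realize (fun o => o.elim r e) := by
  simp [allF, Formula.realize_not]

@[simp]
theorem realize_pairF {s t p : α} {e : α → A} :
    (pairF s t p).Realize e ↔ IsPair (e s) (e t) (e p) := by
  simp [pairF, IsPair]

@[simp]
theorem realize_tupleF {n : ℕ} {α : Type} {f : Fin n → α} {z : α} {e : α → A} :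
    (tupleF f z).Realize e ↔ IsTuple (fun i => e (f i)) (e z) := by
  induction n generalizing α with
  | zero => simp [tupleF, IsTuple]
  | succ n ih =>
    simp only [tupleF, IsTuple, realize_exF, Formula.realize_inf, ih, realize_pairF]
    rfl

/-- `G`, as a set of pairs of an `n`-tuple and an element, is total from `D ^ n` to `D`. -/
def IsTotal (n : ℕ) (D G : A) : Prop :=
  ∀ t : Fin n → A, (∀ i, E (t i) D) → ∃ d, E d D ∧ ∃ z p, IsTuple t z ∧ IsPair z d p ∧ E p G

/-- The formula saying that `G` is total from `D ^ n` to `D`. -/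
noncomputable def totalF (n : ℕ) : setLang.Formula (Fin 2) :=
  Formula.iAlls (Fin n) (Formula.imp (Formula.iInf fun i => memF (Sum.inr i) (Sum.inl 0))
    (exF (memF none (some (Sum.inl 0)) ⊓ exF (exF
      (tupleF (fun i => some (some (some (Sum.inr i)))) (some none) ⊓
        (pairF (some none) (some (some none)) none ⊓
          memF none (some (some (some (Sum.inl 1))))))))))

theorem realize_totalF {n : ℕ} {e : Fin 2 → A} :
    (totalF n).Realize e ↔ IsTotal n (e 0) (e 1) := by
  simp [totalF, IsTotal, Formula.realize_iAlls, Formula.realize_imp]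

end Transfer

theorem isPair_pair {V : Set ZFSet.{u}} (hV : IsTransitiveClass V) {s t p : V}
    (h : (p : ZFSet.{u}) = ZFSet.pair s t) : IsPair s t p := by
  intro z
  have hz : ∀ q : ZFSet.{u}, q ∈ (z : ZFSet.{u}) → q ∈ V := fun q hq => hV _ z.2 _ hq
  rw [E_iff, h]
  simp only [ZFSet.pair, ZFSet.mem_pair, E_iff]
  rw [ZFSet.ext_iff, ZFSet.ext_iff]
  simp only [ZFSet.mem_pair, ZFSet.mem_singleton]
  refine or_congr ⟨fun H r => ?_, fun H r => ⟨fun hr => ?_, fun hr => ?_⟩⟩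
    ⟨fun H r => ?_, fun H r => ⟨fun hr => ?_, fun hr => ?_⟩⟩
  · rw [H, Subtype.ext_iff]
  · exact congrArg Subtype.val ((H ⟨r, hz r hr⟩).1 hr)
  · exact hr ▸ (H s).2 rfl
  · rw [H, Subtype.ext_iff, Subtype.ext_iff]
  · simpa [Subtype.ext_iff] using (H ⟨r, hz r hr⟩).1 hr
  · rcases hr with hr | hr
    · exact hr ▸ (H s).2 (Or.inl rfl)
    · exact hr ▸ (H t).2 (Or.inr rfl)

theorem isTuple_tuple {V : Set ZFSet.{u}} (hV : IsTransitiveClass V) {n : ℕ} (f : Fin n → V)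
    {z : V} (h : (z : ZFSet.{u}) = tuple fun i => (f i : ZFSet.{u})) : IsTuple f z := by
  induction n generalizing z with
  | zero => intro r; rw [E_iff, h]; exact ZFSet.notMem_empty _
  | succ n ih =>
    have h' : (z : ZFSet.{u}) = ZFSet.pair (f 0) (tuple fun i => (f i.succ : ZFSet.{u})) := h
    have hz : tuple (fun i : Fin n => (f i.succ : ZFSet.{u})) ∈ V :=
      SymbolCoding.snd_mem_of_pair hV (h' ▸ z.2)
    exact ⟨⟨_, hz⟩, ih (Fin.tail f) rfl, isPair_pair hV h'⟩

/-! ### The structure `j_std(M)` -/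

section JStd

variable {L : FirstOrder.Language.{a, b}} (c : SymbolCoding.{u} L) {V : Set ZFSet.{u}}
  (hV : IsTransitiveClass V) {W : Type w} [setLang.Structure W] (j : V ↪ₑ[setLang] W)
  {D : ZFSet.{u}} [L.Structure D] (hM : c.structureCode D ∈ V)

/-- The domain of `j_std(M)`: the elements of `W` which belong to `j (D)` in the sense of `W`,
where `D` is the domain of `M`. -/
def JStd : Type w := {r : W // E r (j ⟨D, c.domain_mem hV hM⟩)}

/-- The image under `j` of the interpretation of a symbol in `M`. -/
noncomputable def jInterp (s : L.Symbols) : W := j ⟨SymbolCoding.interpCode D s, c.interpCode_mem hV hM s⟩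

theorem jInterp_total {n : ℕ} (f : L.Functions n) :
    IsTotal n (j ⟨D, c.domain_mem hV hM⟩) (jInterp c hV j hM (.inl ⟨n, f⟩)) := by
  have key := j.map_formula' (totalF n) ![⟨D, c.domain_mem hV hM⟩,
    ⟨SymbolCoding.interpCode D (.inl ⟨n, f⟩), c.interpCode_mem hV hM _⟩]
  rw [realize_totalF, realize_totalF] at key
  refine key.2 fun t ht => ?_
  let t' : Fin n → D := fun i => ⟨t i, ht i⟩
  have hp : ZFSet.pair (tuple fun i => (t' i : ZFSet.{u})) (Structure.funMap f t' : D) ∈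
      SymbolCoding.interpCode D (.inl ⟨n, f⟩) := ZFSet.mem_range.2 ⟨t', rfl⟩
  have hp' := hV _ (c.interpCode_mem hV hM (.inl ⟨n, f⟩)) _ hp
  exact ⟨⟨_, SymbolCoding.snd_mem_of_pair hV hp'⟩, (Structure.funMap f t').2,
    ⟨_, SymbolCoding.fst_mem_of_pair hV hp'⟩, ⟨_, hp'⟩, isTuple_tuple hV t rfl,
    isPair_pair hV rfl, hp⟩

/-- The graph in `W` of a function symbol, on the domain of `j_std(M)`. -/
def JStdGraph {n : ℕ} (f : L.Functions n) (t : Fin n → JStd c hV j hM) (d : JStd c hV j hM) :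
    Prop :=
  ∃ z p : W, IsTuple (fun i => (t i).1) z ∧ IsPair z d.1 p ∧ E p (jInterp c hV j hM (.inl ⟨n, f⟩))

theorem exists_jStdGraph {n : ℕ} (f : L.Functions n) (t : Fin n → JStd c hV j hM) :
    ∃ d, JStdGraph c hV j hM f t d := by
  obtain ⟨d, hd, h⟩ := jInterp_total c hV j hM f (fun i => (t i).1) fun i => (t i).2
  exact ⟨⟨d, hd⟩, h⟩

/-- The structure on `j_std(M)`: each symbol of the (standard) language `L` is interpreted through
the image under `j` of its interpretation in `M`. -/
noncomputable instance instStructureJStd : L.Structure (JStd c hV j hM) where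
  funMap f t := (exists_jStdGraph c hV j hM f t).choose
  RelMap {n} R t :=
    ∃ z : W, IsTuple (fun i => (t i).1) z ∧ E z (jInterp c hV j hM (.inr ⟨n, R⟩))

instance instNonemptyJStd [hD : Nonempty D] : Nonempty (JStd c hV j hM) := by
  obtain ⟨d⟩ := hD
  refine ⟨⟨j ⟨d.1, hV _ (c.domain_mem hV hM) _ d.2⟩, ?_⟩⟩
  have key := j.map_formula' (memF (0 : Fin 2) 1)
    ![⟨d.1, hV _ (c.domain_mem hV hM) _ d.2⟩, ⟨D, c.domain_mem hV hM⟩]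
  rw [realize_memF, realize_memF] at key
  exact key.2 d.2

end JStd

/-! ### Saturation and pseudosaturation -/

/-- `N` realizes every complete type in finitely many variables over the set of parameters `A`. -/
def RealizesTypesOver (L : FirstOrder.Language.{a, b}) (N : Type w) [L.Structure N] [Nonempty N]
    (A : Set N) : Prop :=
  ∀ (n : ℕ) (p : (L[[A]].completeTheory N).CompleteType (Fin n)),
    p ∈ (L[[A]].completeTheory N).realizedTypes N (Fin n)

/-- `N` is `κ`-saturated. -/
def IsSaturated (L : FirstOrder.Language.{a, b}) (κ : Cardinal.{w}) (N : Type w) [L.Structure N]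
    [Nonempty N] : Prop :=
  ∀ A : Set N, #A < κ → RealizesTypesOver L N A

/-- `j_std(M)` is `κ`-pseudosaturated. -/
def IsPseudosaturated {L : FirstOrder.Language.{a, b}} (κ : Cardinal.{w}) (c : SymbolCoding.{u} L)
    {V : Set ZFSet.{u}} (hV : IsTransitiveClass V) {W : Type w} [setLang.Structure W]
    (j : V ↪ₑ[setLang] W) {D : ZFSet.{u}} [L.Structure D] [Nonempty D]
    (hM : c.structureCode D ∈ V) : Prop :=
  ∀ A : Set (JStd c hV j hM), IsPseudofinite (Subtype.val '' A) → #A < κ →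
    RealizesTypesOver L (JStd c hV j hM) A

/-! ### Regular ultrafilters and ultrapowers -/

/-- An ultrafilter `U` on (the power set of) `I` is `λ`-regular, for `λ` the cardinality of `I`:
there is a family of `λ` elements of `U`, every infinite subfamily of which has empty
intersection. -/
def IsRegularUltrafilter {I : Type v} (U : Ultrafilter I) : Prop :=
  ∃ F : Set (Set I), (∀ s ∈ F, s ∈ U) ∧ #F = #I ∧
    ∀ G : Set (Set I), G ⊆ F → G.Infinite → ⋂₀ G = ∅

/-- The ultrapower of `M` by `U`. -/
abbrev Ultrapower {I : Type v} (U : Ultrafilter I) (M : Type w) : Type (max v w) :=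
  (U : Filter I).Product fun _ => M

/-- The Łoś embedding of `M` into its ultrapower. -/
def losEmbedding {I : Type v} (U : Ultrafilter I) (L : FirstOrder.Language.{a, b}) (M : Type w)
    [L.Structure M] (hM : Nonempty M) : M ↪ₑ[L] Ultrapower U M where
  toFun m := ((fun _ => m : I → M) : (U : Filter I).Product fun _ => M)
  map_formula' n φ t := by
    have h := Ultraproduct.realize_formula_cast (M := fun _ : I => M) (u := U) φ (fun i _ => t i)
    exact h.trans (by simp)

end Pseudosat

open Pseudosat

/-!
# Pseudosaturation does not depend on the model of a complete theory

Two models of `T` are elementarily equivalent, so the second player wins each Ehrenfeucht–Fraïssé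
game of finite length between them in which only finitely many symbols matter
(`IsEFEquiv.of_elementarilyEquivalent`), and the first `k` moves of a long game can be used to play
any `k` given elements. In an `ω`-nonstandard extension the length of the game and the number of
symbols can be a nonstandard natural number. Then a nonstandard number of moves always remains and
every standard symbol is respected, so the positions form a true back-and-forth system between the
two structures `j_std(M₀)` and `j_std(M₁)`; moreover, a pseudofinite set of parameters can be played
before the game proper begins. A type over the parameters is then carried to the other structure by
the system, and a realization is carried back (`IsBackAndForth.realizesTypesOver`).

To transfer the game to the extension without coding the syntax of first-order logic in set theory,
the strategy is replaced by a set: a *game system* is a set of pairs of a number of remaining moves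
and a position, closed under the extensions which the game demands (`IsGameSystem`). In `V` it
exists for every winning position, by induction on the number of moves; since the powerset axiom is
not available, collection is used to gather systems for all the possible next moves
(`exists_isGameSystem`). The statement that there are game systems of each length with a position
that covers a given finite set (`HasGameSystems`) is a single sentence with parameters in `V`, and
is transferred by `j`; this gives `isBackAndForth_jSystem` and
`IsPseudosaturated.of_elementarilyEquivalent`. That a notion is first-order, with the same formula
in both structures, is recorded by the class `DefPair`, whose instances follow the syntax of Lean
propositions.

For the ultrapower of `V` by a regular ultrafilter, regularity gives a function to `ω` which tends
to infinity and, for each set of at most `λ` elements, a cover by finite sets, index by index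
(`IsRegularUltrafilter.exists_finite_cover`); by Łoś's theorem they represent a nonstandard number
and an internally finite set which covers the given set.

Keisler's theorem concerns models which need not belong to a model of set theory. For it, the same
argument is carried out in the ultrapowers of `M₀` and `M₁` themselves: families of winning
positions whose numbers of remaining moves and of symbols tend to infinity form a back-and-forth
system (`isBackAndForth_efSystem`).
-/

namespace Pseudosat

/-! ### Saturation in terms of finitely satisfiable sets of formulas -/

section Types

variable {L : FirstOrder.Language.{a, b}} {N : Type w} [L.Structure N] [Nonempty N]

/-- Realizing all complete types is the same as realizing all finitely satisfiable sets of formulas: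
such a set extends to a complete type, and a complete type over the complete theory of `N` is
finitely satisfiable in `N` itself. -/
theorem forall_completeType_realized_iff {α : Type x} :
    (∀ p : (L.completeTheory N).CompleteType α,
      p ∈ (L.completeTheory N).realizedTypes N α) ↔
    ∀ Γ : Set (L.Formula α),
      (∀ Γ₀ : Finset (L.Formula α), (Γ₀ : Set (L.Formula α)) ⊆ Γ →
        ∃ v : α → N, ∀ φ ∈ Γ₀, φ.Realize v) →
      ∃ v : α → N, ∀ φ ∈ Γ, φ.Realize v := by
  classical
  constructor
  · intro h Γ hΓ
    have hsat : ((L.lhomWithConstants α).onTheory (L.completeTheory N) ∪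
        Formula.equivSentence '' Γ).IsSatisfiable := by
      rw [Theory.isSatisfiable_iff_isFinitelySatisfiable]
      intro T₀ hT₀
      obtain ⟨v, hv⟩ := hΓ ((T₀.image Formula.equivSentence.symm).filter (· ∈ Γ))
        (by intro φ hφ; simpa using (Finset.mem_filter.1 hφ).2)
      let : (constantsOn α).Structure N := constantsOn.structure v
      have : N ⊨ (T₀ : L[[α]].Theory) := by
        refine ⟨fun φ hφ => ?_⟩
        rcases hT₀ hφ with hφ' | ⟨ψ, hψ, rfl⟩
        · exact ((LHom.onTheory_model (L.lhomWithConstants α) (L.completeTheory N)).2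
            inferInstance).realize_of_mem _ hφ'
        · refine (Formula.realize_equivSentence N ψ).2 (hv ψ ?_)
          refine Finset.mem_filter.2 ⟨Finset.mem_image.2 ⟨_, hφ, by simp⟩, hψ⟩
      exact Theory.Model.isSatisfiable N
    have hne : {p : (L.completeTheory N).CompleteType α |
        Formula.equivSentence '' Γ ⊆ (p : L[[α]].Theory)} ≠ ∅ := fun he =>
      (Theory.CompleteType.setOfPred_subset_eq_empty_iff _).1 he hsat
    obtain ⟨p, hp⟩ := Set.nonempty_iff_ne_empty.2 hne
    obtain ⟨v, rfl⟩ := h p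
    exact ⟨v, fun φ hφ => Theory.CompleteType.formula_mem_typeOf.1 (hp ⟨φ, hφ, rfl⟩)⟩
  · intro h p
    obtain ⟨v, hv⟩ := h {φ | Formula.equivSentence φ ∈ p} fun Γ₀ hΓ₀ => by
      by_contra hno
      push Not at hno
      let ψ : L.Formula α := (Formula.iInf fun φ : Γ₀ => φ.1).not
      have hψ : ∀ v : α → N, ψ.Realize v := by
        intro v
        obtain ⟨φ, hφ, hn⟩ := hno v
        simp only [ψ, Formula.realize_not, Formula.realize_iInf]
        exact fun H => hn (H ⟨φ, hφ⟩)
      have hmod : L.completeTheory N ⊨ᵇ ψ := by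
        have hcl : N ⊨ (ψ.not.exClosure).not := by
          rw [Sentence.realize_not, Formula.realize_exClosure]
          rintro ⟨v, hv⟩
          let v' : α → N := fun a => if ha : a ∈ ψ.not.freeVarFinset then v ⟨a, ha⟩ else
            Classical.arbitrary N
          have := (BoundedFormula.realize_restrictFreeVar (f := id) (v := v) v'
            (fun a => by simp only [v', id]; rw [dif_pos a.2])).1 hv
          exact (Formula.realize_not.1 this) (hψ v')
        refine Theory.models_formula_iff.2 fun M v => ?_
        have hM : M ⊨ (ψ.not.exClosure).not :=
          Theory.realize_sentence_of_mem (L.completeTheory N) hcl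
        rw [Sentence.realize_not, Formula.realize_exClosure] at hM
        by_contra hv
        refine hM ⟨fun a => v a, ?_⟩
        exact (BoundedFormula.realize_restrictFreeVar (f := id) v
            (fun a => rfl)).2 (Formula.realize_not.2 hv)
      have hmem := p.mem_of_models
        (Theory.models_formula_iff_onTheory_models_equivSentence.1 hmod)
      obtain ⟨M, hM⟩ := Theory.exists_modelType_is_realized_in _ p
      obtain ⟨v, rfl⟩ := hM
      rw [Theory.CompleteType.formula_mem_typeOf] at hmem
      refine (Formula.realize_not.1 hmem) (Formula.realize_iInf.2 fun φ => ?_)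
      have hφ : Formula.equivSentence φ.1 ∈ (L.completeTheory N).typeOf v := hΓ₀ φ.2
      exact Theory.CompleteType.formula_mem_typeOf.1 hφ
    refine ⟨v, SetLike.ext fun φ => ?_⟩
    have hsub : ∀ φ, φ ∈ p → φ ∈ (L.completeTheory N).typeOf v := by
      intro φ hφ
      rw [Theory.CompleteType.mem_typeOf]
      exact hv _ (by simpa using hφ)
    refine ⟨fun hφ => ?_, hsub φ⟩
    by_contra hn
    exact (Theory.CompleteType.not_mem_iff _ φ).1
      (hsub _ ((p.mem_or_not_mem φ).resolve_left hn)) hφ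

/-- The form of `RealizesTypesOver` used below: the parameters are variables whose value is fixed,
so that it only mentions formulas of `L`, and formulas can be moved between structures by
relabelling. -/
theorem realizesTypesOver_iff {A : Set N} :
    RealizesTypesOver L N A ↔ ∀ (n : ℕ) (Γ : Set (L.Formula (A ⊕ Fin n))),
      (∀ Γ₀ : Finset (L.Formula (A ⊕ Fin n)), (Γ₀ : Set (L.Formula (A ⊕ Fin n))) ⊆ Γ →
        ∃ v : Fin n → N, ∀ φ ∈ Γ₀, φ.Realize (Sum.elim (↑) v)) →
      ∃ v : Fin n → N, ∀ φ ∈ Γ, φ.Realize (Sum.elim (↑) v) := by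
  classical
  have key : ∀ {n : ℕ} (φ : L[[A]].Formula (Fin n)) (v : Fin n → N),
      Formula.Realize (BoundedFormula.constantsVarsEquiv φ : L.Formula (A ⊕ Fin n))
        (Sum.elim (↑) v) ↔ φ.Realize v := by
    intro n φ v
    have := BoundedFormula.realize_constantsVarsEquiv (φ := φ) (v := v) (xs := default) (M := N)
    simpa [Formula.Realize] using this
  refine forall_congr' fun n => forall_completeType_realized_iff.trans
    ⟨fun h Γ hΓ => ?_, fun h Γ hΓ => ?_⟩
  · obtain ⟨v, hv⟩ := h (BoundedFormula.constantsVarsEquiv ⁻¹' Γ) fun Γ₀ hΓ₀ => by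
      obtain ⟨v, hv⟩ := hΓ (Γ₀.image BoundedFormula.constantsVarsEquiv) (by
        intro φ hφ
        obtain ⟨ψ, hψ, rfl⟩ := Finset.mem_image.1 hφ
        exact hΓ₀ hψ)
      exact ⟨v, fun φ hφ => (key φ v).1 (hv _ (Finset.mem_image_of_mem _ hφ))⟩
    refine ⟨v, fun φ hφ => ?_⟩
    have := (key (BoundedFormula.constantsVarsEquiv.symm φ) v).2
      (hv _ (by simpa using hφ))
    simpa using this
  · obtain ⟨v, hv⟩ := h (BoundedFormula.constantsVarsEquiv.symm ⁻¹' Γ) fun Γ₀ hΓ₀ => by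
      obtain ⟨v, hv⟩ := hΓ (Γ₀.image BoundedFormula.constantsVarsEquiv.symm) (by
        intro φ hφ
        obtain ⟨ψ, hψ, rfl⟩ := Finset.mem_image.1 hφ
        exact hΓ₀ hψ)
      refine ⟨v, fun φ hφ => ?_⟩
      have := (key _ v).2 (hv _ (Finset.mem_image_of_mem _ hφ))
      simpa using this
    exact ⟨v, fun φ hφ => (key φ v).1 (hv _ (by simpa using hφ))⟩

end Types

/-! ### Back-and-forth systems -/

section BackAndForth

variable {L : FirstOrder.Language.{a, b}} {M : Type x} {N : Type y} [L.Structure M] [L.Structure N]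

/-- The relation `g` between `M` and `N` is single-valued and injective, and it respects each symbol
`s` with `P s`. -/
structure IsPartialIso (P : L.Symbols → Prop) (g : Set (M × N)) : Prop where
  eq_iff : ∀ p ∈ g, ∀ q ∈ g, p.1 = q.1 ↔ p.2 = q.2
  funMap_iff : ∀ {n : ℕ} (f : L.Functions n), P (.inl ⟨n, f⟩) → ∀ (s : Fin n → M) (t : Fin n → N),
    (∀ i, (s i, t i) ∈ g) → ∀ p ∈ g, Structure.funMap f s = p.1 ↔ Structure.funMap f t = p.2
  relMap_iff : ∀ {n : ℕ} (R : L.Relations n), P (.inr ⟨n, R⟩) → ∀ (s : Fin n → M) (t : Fin n → N),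
    (∀ i, (s i, t i) ∈ g) → (Structure.RelMap R s ↔ Structure.RelMap R t)

variable (L) in
/-- `S` is a back-and-forth system of partial isomorphisms between `M` and `N`. -/
structure IsBackAndForth (S : Set (Set (M × N))) : Prop where
  isPartialIso : ∀ g ∈ S, IsPartialIso (L := L) (fun _ => True) g
  forth : ∀ g ∈ S, ∀ m : M, ∃ n : N, ∃ g' ∈ S, g ⊆ g' ∧ (m, n) ∈ g'
  back : ∀ g ∈ S, ∀ n : N, ∃ m : M, ∃ g' ∈ S, g ⊆ g' ∧ (m, n) ∈ g'

namespace IsBackAndForth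

variable {S : Set (Set (M × N))}

theorem forth_tuple (hS : IsBackAndForth L S) {g : Set (M × N)} (hg : g ∈ S) {n : ℕ}
    (s : Fin n → M) : ∃ t : Fin n → N, ∃ g' ∈ S, g ⊆ g' ∧ ∀ i, (s i, t i) ∈ g' := by
  induction n with
  | zero => exact ⟨Fin.elim0, g, hg, subset_rfl, fun i => i.elim0⟩
  | succ n ih =>
    obtain ⟨t, g₁, hg₁, hsub, ht⟩ := ih (Fin.tail s)
    obtain ⟨b, g₂, hg₂, hsub', hb⟩ := hS.forth g₁ hg₁ (s 0)
    refine ⟨Fin.cons b t, g₂, hg₂, hsub.trans hsub', fun i => ?_⟩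
    refine Fin.cases hb (fun i => ?_) i
    exact hsub' (ht i)

theorem back_tuple (hS : IsBackAndForth L S) {g : Set (M × N)} (hg : g ∈ S) {n : ℕ}
    (t : Fin n → N) : ∃ s : Fin n → M, ∃ g' ∈ S, g ⊆ g' ∧ ∀ i, (s i, t i) ∈ g' := by
  induction n with
  | zero => exact ⟨Fin.elim0, g, hg, subset_rfl, fun i => i.elim0⟩
  | succ n ih =>
    obtain ⟨s, g₁, hg₁, hsub, hs⟩ := ih (Fin.tail t)
    obtain ⟨b, g₂, hg₂, hsub', hb⟩ := hS.back g₁ hg₁ (t 0)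
    refine ⟨Fin.cons b s, g₂, hg₂, hsub.trans hsub', fun i => ?_⟩
    refine Fin.cases hb (fun i => ?_) i
    exact hsub' (hs i)

/-- The values of a term lie on a member of the system: the arguments of the outermost function are
treated one after another, and a last extension adds the value itself. -/
theorem exists_mem_term (hS : IsBackAndForth L S) {α : Type w} (τ : L.Term α) {g : Set (M × N)}
    (hg : g ∈ S) {s : α → M} {t : α → N} (hst : ∀ i, (s i, t i) ∈ g) :
    ∃ g' ∈ S, g ⊆ g' ∧ (τ.realize s, τ.realize t) ∈ g' := by
  induction τ generalizing g with
  | var i => exact ⟨g, hg, subset_rfl, hst i⟩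
  | @func n f ts ih =>
    have hargs : ∀ k ≤ n, ∃ g' ∈ S, g ⊆ g' ∧
        ∀ i : Fin n, i.1 < k → ((ts i).realize s, (ts i).realize t) ∈ g' := by
      intro k
      induction k with
      | zero => exact fun _ => ⟨g, hg, subset_rfl, fun i hi => absurd hi (Nat.not_lt_zero _)⟩
      | succ k ihk =>
        intro hk
        obtain ⟨g₁, hg₁, hsub, h₁⟩ := ihk (by omega)
        obtain ⟨g₂, hg₂, hsub', h₂⟩ := ih ⟨k, hk⟩ hg₁ fun i => hsub (hst i)
        refine ⟨g₂, hg₂, hsub.trans hsub', fun i hi => ?_⟩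
        rcases Nat.lt_succ_iff_lt_or_eq.1 hi with hi | hi
        · exact hsub' (h₁ i hi)
        · obtain rfl : i = ⟨k, hk⟩ := Fin.ext hi
          exact h₂
    obtain ⟨g₁, hg₁, hsub, h₁⟩ := hargs n le_rfl
    obtain ⟨b, g₂, hg₂, hsub', h₂⟩ := hS.forth g₁ hg₁ (Term.realize s (.func f ts))
    have := ((hS.isPartialIso g₂ hg₂).funMap_iff f trivial (fun i => (ts i).realize s)
      (fun i => (ts i).realize t) (fun i => hsub' (h₁ i i.2)) _ h₂).1 rfl
    refine ⟨g₂, hg₂, hsub.trans hsub', ?_⟩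
    rw [Term.realize_func t, this]
    exact h₂

theorem realize_boundedFormula_iff (hS : IsBackAndForth L S) {α : Type w} {n : ℕ}
    (φ : L.BoundedFormula α n) {g : Set (M × N)} (hg : g ∈ S) {s : α → M} {t : α → N}
    (hst : ∀ i, (s i, t i) ∈ g) {s' : Fin n → M} {t' : Fin n → N}
    (hst' : ∀ i, (s' i, t' i) ∈ g) : φ.Realize s s' ↔ φ.Realize t t' := by
  induction φ generalizing g with
  | falsum => rfl
  | @equal n t₁ t₂ =>
    have h : ∀ i, (Sum.elim s s' i, Sum.elim t t' i) ∈ g := Sum.rec hst hst'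
    obtain ⟨g₁, hg₁, hsub, h₁⟩ := hS.exists_mem_term t₁ hg h
    obtain ⟨g₂, hg₂, hsub', h₂⟩ := hS.exists_mem_term t₂ hg₁ fun i => hsub (h i)
    exact (hS.isPartialIso g₂ hg₂).eq_iff _ (hsub' h₁) _ h₂
  | @rel n m R ts =>
    have h : ∀ i, (Sum.elim s s' i, Sum.elim t t' i) ∈ g := Sum.rec hst hst'
    obtain ⟨b, g₁, hg₁, hsub, h₁⟩ :=
      hS.forth_tuple hg (fun i => (ts i).realize (Sum.elim s s'))
    have hb : b = fun i => (ts i).realize (Sum.elim t t') := by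
      funext i
      obtain ⟨g₂, hg₂, hsub', h₂⟩ := hS.exists_mem_term (ts i) hg₁ fun i => hsub (h i)
      exact ((hS.isPartialIso g₂ hg₂).eq_iff _ (hsub' (h₁ i)) _ h₂).1 rfl
    subst hb
    exact (hS.isPartialIso g₁ hg₁).relMap_iff R trivial _ _ h₁
  | imp φ ψ ih₁ ih₂ => exact imp_congr (ih₁ hg hst hst') (ih₂ hg hst hst')
  | @all n φ ih =>
    have hsnoc : ∀ {g' : Set (M × N)} {m : M} {k : N}, g ⊆ g' → (m, k) ∈ g' →
        ∀ i, ((Fin.snoc s' m : Fin (n + 1) → M) i, (Fin.snoc t' k : Fin (n + 1) → N) i) ∈ g' := by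
      intro g' m k hsub hm i
      refine Fin.lastCases ?_ (fun i => ?_) i
      · simpa using hm
      · simpa using hsub (hst' i)
    rw [BoundedFormula.realize_all, BoundedFormula.realize_all]
    constructor
    · intro H k
      obtain ⟨m, g', hg', hsub, hm⟩ := hS.back g hg k
      exact (ih hg' (fun i => hsub (hst i)) (hsnoc hsub hm)).1 (H m)
    · intro H m
      obtain ⟨k, g', hg', hsub, hm⟩ := hS.forth g hg m
      exact (ih hg' (fun i => hsub (hst i)) (hsnoc hsub hm)).2 (H k)

theorem realize_formula_iff (hS : IsBackAndForth L S) {α : Type w} (φ : L.Formula α)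
    {g : Set (M × N)} (hg : g ∈ S) {s : α → M} {t : α → N} (hst : ∀ i, (s i, t i) ∈ g) :
    φ.Realize s ↔ φ.Realize t :=
  hS.realize_boundedFormula_iff φ hg hst fun i => i.elim0

/-- Types over parameters in the domain of a member of a back-and-forth system are transported to
the image of the parameters, and their realizations are transported back. -/
theorem realizesTypesOver [Nonempty M] [Nonempty N] (hS : IsBackAndForth L S) {g : Set (M × N)}
    (hg : g ∈ S) {A : Set M} {h : A → N} (hA : ∀ m : A, (m.1, h m) ∈ g)
    (hB : RealizesTypesOver L N (Set.range h)) : RealizesTypesOver L M A := by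
  classical
  rw [realizesTypesOver_iff] at hB ⊢
  intro n Γ hΓ
  let ρ : A ⊕ Fin n → Set.range h ⊕ Fin n := Sum.map (Set.rangeFactorization h) id
  have hρ : ∀ t : Fin n → N, (Sum.elim ((↑) : Set.range h → N) t) ∘ ρ = Sum.elim h t := by
    intro t; funext i; cases i <;> rfl
  obtain ⟨t, ht⟩ := hB n (Formula.relabel ρ '' Γ) fun Γ₀ hΓ₀ => by
    obtain ⟨Γ₁, hΓ₁, rfl⟩ := Finset.subset_set_image_iff.1 hΓ₀
    obtain ⟨s, hs⟩ := hΓ Γ₁ hΓ₁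
    obtain ⟨t, g', hg', hsub, hst⟩ := hS.forth_tuple hg s
    refine ⟨t, fun φ hφ => ?_⟩
    obtain ⟨ψ, hψ, rfl⟩ := Finset.mem_image.1 hφ
    rw [Formula.realize_relabel, hρ]
    refine (hS.realize_formula_iff ψ hg' ?_).1 (hs ψ hψ)
    rintro (i | i)
    exacts [hsub (hA i), hst i]
  obtain ⟨s, g', hg', hsub, hst⟩ := hS.back_tuple hg t
  refine ⟨s, fun ψ hψ => ?_⟩
  have := ht _ ⟨ψ, hψ, rfl⟩
  rw [Formula.realize_relabel, hρ] at this
  refine (hS.realize_formula_iff ψ hg' ?_).2 this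
  rintro (i | i)
  exacts [hsub (hA i), hst i]

end IsBackAndForth

end BackAndForth

/-! ### Ehrenfeucht–Fraïssé equivalence -/

section EF

variable {L : FirstOrder.Language.{a, b}} {M : Type x} {N : Type y} [L.Structure M] [L.Structure N]

/-- The formula saying that some further element satisfies, together with the variables, exactly the
formulas of the finite set `Γ` that belong to `Θ`. -/
noncomputable def existsDescription {L : FirstOrder.Language.{a, b}} {m : ℕ}
    (Γ : Set (L.Formula (Fin (m + 1)))) [Finite Γ] (Θ : Set Γ) : L.Formula (Fin m) :=
  open Classical in
  Formula.iExs (Fin 1) (Formula.relabel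
    (Fin.snoc (α := fun _ => Fin m ⊕ Fin 1) Sum.inl (Sum.inr 0) : Fin (m + 1) → Fin m ⊕ Fin 1)
    (Formula.iInf fun φ : Γ => if φ ∈ Θ then φ.1 else φ.1.not))

theorem realize_existsDescription {L : FirstOrder.Language.{a, b}} {m : ℕ}
    {Γ : Set (L.Formula (Fin (m + 1)))} [Finite Γ] {Θ : Set Γ} {K : Type w} [L.Structure K]
    {s : Fin m → K} : (existsDescription Γ Θ).Realize s ↔
      ∃ c : K, ∀ φ : Γ, φ ∈ Θ ↔ φ.1.Realize (Fin.snoc (α := fun _ => K) s c) := by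
  classical
  have hρ : ∀ c : Fin 1 → K, Sum.elim s c ∘
      (Fin.snoc (α := fun _ => Fin m ⊕ Fin 1) Sum.inl (Sum.inr 0) : Fin (m + 1) → Fin m ⊕ Fin 1) =
        Fin.snoc (α := fun _ => K) s (c 0) := by
    intro c
    funext i
    refine Fin.lastCases ?_ (fun i => ?_) i <;> simp
  simp only [existsDescription, Formula.realize_iExs, Formula.realize_relabel, hρ,
    Formula.realize_iInf]
  have key : ∀ (φ : Γ) (e : Fin (m + 1) → K),
      (if φ ∈ Θ then φ.1 else φ.1.not).Realize e ↔ (φ ∈ Θ ↔ φ.1.Realize e) := by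
    intro φ e
    split_ifs with hφ
    · simp [hφ]
    · simp [hφ, Formula.realize_not]
  simp only [key]
  exact ⟨fun ⟨c, hc⟩ => ⟨c 0, hc⟩, fun ⟨c, hc⟩ => ⟨fun _ => c, hc⟩⟩

/-- The second player wins the Ehrenfeucht–Fraïssé game with `k` remaining moves from the
position `f`, where only the symbols with index less than `n` are taken into account. -/
def IsEFEquiv (idx : L.Symbols → ℕ) (n : ℕ) : ℕ → Set (M × N) → Prop
  | 0, f => IsPartialIso (fun s => idx s < n) f
  | k + 1, f => IsEFEquiv idx n k f ∧ (∀ c, ∃ d, IsEFEquiv idx n k (insert (c, d) f)) ∧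
      ∀ d, ∃ c, IsEFEquiv idx n k (insert (c, d) f)

namespace IsEFEquiv

variable {idx : L.Symbols → ℕ} {n : ℕ}

theorem isPartialIso {k : ℕ} {f : Set (M × N)} (h : IsEFEquiv idx n k f) :
    IsPartialIso (fun s => idx s < n) f := by
  induction k with
  | zero => exact h
  | succ k ih => exact ih h.1

/-- If enough moves remain, the first player can play all elements of a finite set. -/
theorem exists_extension {k : ℕ} {f : Set (M × N)} (hf : f.Finite) {X : Set M} (hX : X.Finite)
    (h : IsEFEquiv idx n (k + X.ncard) f) :
    ∃ g : Set (M × N), g.Finite ∧ IsEFEquiv idx n k g ∧ ∀ c ∈ X, ∃ d, (c, d) ∈ g := by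
  -- the induction on `X` needs the extension of `f`, which keeps the answers given before
  suffices H : ∃ g : Set (M × N), g.Finite ∧ f ⊆ g ∧ IsEFEquiv idx n k g ∧
      ∀ c ∈ X, ∃ d, (c, d) ∈ g by
    obtain ⟨g, h₁, -, h₂⟩ := H
    exact ⟨g, h₁, h₂⟩
  induction X, hX using Set.Finite.induction_on generalizing f with
  | empty => exact ⟨f, hf, subset_rfl, by simpa using h, by simp⟩
  | @insert c X hc hX ih =>
    rw [Set.ncard_insert_of_notMem hc hX] at h
    obtain ⟨d, hd⟩ := h.2.1 c
    obtain ⟨g, hg, hsub, hk, hgX⟩ := ih (hf.insert _) hd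
    refine ⟨g, hg, (Set.subset_insert _ _).trans hsub, hk, ?_⟩
    rintro c' (rfl | hc')
    exacts [⟨d, hsub (Set.mem_insert _ _)⟩, hgX c' hc']

variable (M N) in
/-- The formulas are the equations between variables and the unnested atomic formulas formed with
the finitely many symbols of index less than `n`. -/
theorem exists_finite_atomicFormulas (hidx : Function.Injective idx) (n m : ℕ) :
    ∃ Γ : Set (L.Formula (Fin m)), Γ.Finite ∧ ∀ (s : Fin m → M) (t : Fin m → N),
      (∀ φ ∈ Γ, φ.Realize s ↔ φ.Realize t) →
        IsPartialIso (fun s => idx s < n) (Set.range fun i => (s i, t i)) := by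
  have hfin : Finite {s : L.Symbols // idx s < n} :=
    Finite.of_injective (fun s => (⟨idx s.1, s.2⟩ : Fin n)) fun s t hst =>
      Subtype.ext (hidx (Fin.ext_iff.1 hst))
  have hF : Finite {f : Σ l, L.Functions l // idx (.inl f) < n} :=
    Finite.of_injective (fun f => (⟨.inl f.1, f.2⟩ : {s : L.Symbols // idx s < n}))
      fun f g hfg => Subtype.ext (Sum.inl_injective (Subtype.ext_iff.1 hfg))
  have hR : Finite {R : Σ l, L.Relations l // idx (.inr R) < n} :=
    Finite.of_injective (fun f => (⟨.inr f.1, f.2⟩ : {s : L.Symbols // idx s < n}))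
      fun f g hfg => Subtype.ext (Sum.inr_injective (Subtype.ext_iff.1 hfg))
  let eqs : Fin m × Fin m → L.Formula (Fin m) := fun p => Term.equal (.var p.1) (.var p.2)
  let funs : ((Σ f : {f : Σ l, L.Functions l // idx (.inl f) < n}, (Fin f.1.1 → Fin m)) × Fin m) →
      L.Formula (Fin m) := fun p =>
    Term.equal (.func p.1.1.1.2 fun i => .var (p.1.2 i)) (.var p.2)
  let rels : (Σ R : {R : Σ l, L.Relations l // idx (.inr R) < n}, (Fin R.1.1 → Fin m)) →
      L.Formula (Fin m) := fun p => Relations.formula p.1.1.2 fun i => .var (p.2 i)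
  refine ⟨Set.range eqs ∪ Set.range funs ∪ Set.range rels,
    ((Set.finite_range _).union (Set.finite_range _)).union (Set.finite_range _),
    fun s t hst => ⟨?_, ?_, ?_⟩⟩
  · rintro _ ⟨i, rfl⟩ _ ⟨i', rfl⟩
    have := hst (eqs (i, i')) (Or.inl (Or.inl ⟨_, rfl⟩))
    simpa [eqs] using this
  · rintro l f hf c d hcd _ ⟨i, rfl⟩
    choose σ hσ using hcd
    obtain rfl : (fun i => s (σ i)) = c := funext fun i => congrArg Prod.fst (hσ i)
    obtain rfl : (fun i => t (σ i)) = d := funext fun i => congrArg Prod.snd (hσ i)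
    have := hst (funs (⟨⟨⟨l, f⟩, hf⟩, σ⟩, i)) (Or.inl (Or.inr ⟨_, rfl⟩))
    simpa [funs] using this
  · rintro l R hR c d hcd
    choose σ hσ using hcd
    obtain rfl : (fun i => s (σ i)) = c := funext fun i => congrArg Prod.fst (hσ i)
    obtain rfl : (fun i => t (σ i)) = d := funext fun i => congrArg Prod.snd (hσ i)
    have := hst (rels ⟨⟨⟨l, R⟩, hR⟩, σ⟩) (Or.inr ⟨_, rfl⟩)
    simpa [rels, Formula.realize_rel] using this

variable (M N) in
/-- Finitely many formulas decide Ehrenfeucht–Fraïssé equivalence: for one more move, the formulas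
that are needed say which complete descriptions, in terms of the formulas for the remaining moves,
are realized by a further element. -/
theorem exists_finite_formulas (hidx : Function.Injective idx) (n k m : ℕ) :
    ∃ Γ : Set (L.Formula (Fin m)), Γ.Finite ∧ ∀ (s : Fin m → M) (t : Fin m → N),
      (∀ φ ∈ Γ, φ.Realize s ↔ φ.Realize t) →
        IsEFEquiv idx n k (Set.range fun i => (s i, t i)) := by
  induction k generalizing m with
  | zero => exact exists_finite_atomicFormulas M N hidx n m
  | succ k ih =>
    obtain ⟨Γ₀, hΓ₀, h₀⟩ := ih m
    obtain ⟨Γ₁, hΓ₁, h₁⟩ := ih (m + 1)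
    have : Finite Γ₁ := hΓ₁
    have hins : ∀ (s : Fin m → M) (t : Fin m → N) (c : M) (d : N),
        insert (c, d) (Set.range fun i => (s i, t i)) = Set.range fun i : Fin (m + 1) =>
          ((Fin.snoc (α := fun _ => M) s c) i, (Fin.snoc (α := fun _ => N) t d) i) := by
      intro s t c d
      ext p
      simp only [Set.mem_insert_iff, Set.mem_range, Fin.exists_fin_succ', Fin.snoc_castSucc,
        Fin.snoc_last]
      tauto
    refine ⟨Γ₀ ∪ Set.range (existsDescription Γ₁), hΓ₀.union (Set.finite_range _),
      fun s t hst => ⟨?_, ?_, ?_⟩⟩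
    · exact h₀ s t fun φ hφ => hst φ (Or.inl hφ)
    · intro c
      obtain ⟨d, hd⟩ := (realize_existsDescription (s := t)).1 ((hst _ (Or.inr
        ⟨{φ | φ.1.Realize (Fin.snoc (α := fun _ => M) s c)}, rfl⟩)).1
        ((realize_existsDescription (s := s)).2 ⟨c, fun φ => Iff.rfl⟩))
      exact ⟨d, hins s t c d ▸ h₁ _ _ fun φ hφ => hd ⟨φ, hφ⟩⟩
    · intro d
      obtain ⟨c, hc⟩ := (realize_existsDescription (s := s)).1 ((hst _ (Or.inr
        ⟨{φ | φ.1.Realize (Fin.snoc (α := fun _ => N) t d)}, rfl⟩)).2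
        ((realize_existsDescription (s := t)).2 ⟨d, fun φ => Iff.rfl⟩))
      exact ⟨c, hins s t c d ▸ h₁ _ _ fun φ hφ => (hc ⟨φ, hφ⟩).symm⟩

theorem of_elementarilyEquivalent (hidx : Function.Injective idx) (hMN : M ≅[L] N) (n k : ℕ) :
    IsEFEquiv idx n k (∅ : Set (M × N)) := by
  obtain ⟨Γ, -, h⟩ := exists_finite_formulas M N hidx n k 0
  have := h Fin.elim0 Fin.elim0 fun φ _ => by
    have := hMN.realize_sentence (Formula.relabel (Fin.elim0 : Fin 0 → Empty) φ)
    simp only [Sentence.Realize, Formula.realize_relabel] at this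
    rwa [Subsingleton.elim ((default : Empty → M) ∘ Fin.elim0) Fin.elim0,
      Subsingleton.elim ((default : Empty → N) ∘ Fin.elim0) Fin.elim0] at this
  convert this
  simp

theorem exists_of_elementarilyEquivalent (hidx : Function.Injective idx) (hMN : M ≅[L] N) (n k : ℕ)
    {X : Set M} (hX : X.Finite) :
    ∃ g : Set (M × N), g.Finite ∧ IsEFEquiv idx n k g ∧ ∀ c ∈ X, ∃ d, (c, d) ∈ g :=
  -- start from the empty position with `k + X.ncard` moves
  exists_extension Set.finite_empty hX (of_elementarilyEquivalent hidx hMN n _)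

end IsEFEquiv

end EF

/-! ### Regular ultrafilters -/

section Regular

variable {I : Type v} {U : Ultrafilter I}

/-- The finite approximations to `X` given by regularity: attach distinct members of the regular
family to the elements of `X`; each index lies in only finitely many of them. -/
theorem IsRegularUltrafilter.exists_finite_cover (hU : IsRegularUltrafilter U) {X : Type x}
    (hX : lift.{v} #X ≤ lift.{x} #I) :
    ∃ F : I → Set X, (∀ i, (F i).Finite) ∧ ∀ c, ∀ᶠ i in (U : Filter I), c ∈ F i := by
  obtain ⟨F, hFU, hFI, hF⟩ := hU
  rw [← hFI, Cardinal.lift_mk_le'] at hX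
  obtain ⟨e⟩ := hX
  refine ⟨fun i => {c | i ∈ (e c).1}, fun i => ?_, fun c => hFU _ (e c).2⟩
  have hfin : {s | s ∈ F ∧ i ∈ s}.Finite := by
    by_contra hinf
    have h := hF _ (fun s hs => hs.1) hinf
    exact Set.notMem_empty i (h ▸ Set.mem_sInter.2 fun s hs => hs.2)
  refine Set.Finite.of_finite_image (hfin.subset (s := {s | s ∈ F ∧ i ∈ s})
    (t := (fun c => (e c).1) '' _) ?_) fun c _ d _ hcd => e.injective (Subtype.ext hcd)
  rintro _ ⟨c, hc, rfl⟩
  exact ⟨(e c).2, hc⟩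

theorem IsRegularUltrafilter.exists_tendsto [Infinite I] (hU : IsRegularUltrafilter U) :
    ∃ n : I → ℕ, Filter.Tendsto n U Filter.atTop := by
  obtain ⟨F, hF, h⟩ := hU.exists_finite_cover (X := ℕ) (by simp)
  refine ⟨fun i => (F i).ncard, Filter.tendsto_atTop.2 fun k => ?_⟩
  have : ∀ᶠ i in (U : Filter I), ∀ l ∈ Finset.range k, l ∈ F i :=
    (Filter.eventually_all_finset _).2 fun l _ => h l
  filter_upwards [this] with i hi
  have := Set.ncard_le_ncard (s := (Finset.range k : Set ℕ)) (fun l hl => hi l hl) (hF i)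
  simpa using this

end Regular

/-! ### Regular ultrapowers of elementarily equivalent structures -/

section Ultrapower

variable {I : Type v} {U : Ultrafilter I} {L : FirstOrder.Language.{a, b}} {M : Type x} {N : Type y}

/-- The relation between two ultrapowers induced by a family of relations. -/
def ultraRel (U : Ultrafilter I) (F : I → Set (M × N)) : Set (Ultrapower U M × Ultrapower U N) :=
  {p | ∃ s t, p.1 = Quotient.mk'' s ∧ p.2 = Quotient.mk'' t ∧
    ∀ᶠ i in (U : Filter I), (s i, t i) ∈ F i}

theorem mk_eq_mk_iff {s t : I → M} :
    (Quotient.mk'' s : Ultrapower U M) = Quotient.mk'' t ↔ ∀ᶠ i in (U : Filter I), s i = t i :=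
  Quotient.eq''

variable [L.Structure M] [L.Structure N]

theorem relMap_mk_iff {l : ℕ} (R : L.Relations l) (s : Fin l → I → M) :
    Structure.RelMap R (fun j => (Quotient.mk'' (s j) : Ultrapower U M)) ↔
      ∀ᶠ i in (U : Filter I), Structure.RelMap R fun j => s j i :=
  relMap_quotient_mk' (s := (U : Filter I).productSetoid fun _ => M) R s

open Filter in
variable (U) (M) (N) in
/-- The relations between two ultrapowers induced by Ehrenfeucht–Fraïssé positions for which both
the number of remaining moves and the number of symbols tend to infinity. -/
def efSystem (idx : L.Symbols → ℕ) : Set (Set (Ultrapower U M × Ultrapower U N)) :=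
  {g | ∃ (F : I → Set (M × N)) (n k : I → ℕ), g = ultraRel U F ∧
    (∀ i, IsEFEquiv idx (n i) (k i) (F i)) ∧ Tendsto n U atTop ∧ Tendsto k U atTop}

/-- Each symbol is respected by almost all of the relations `F i`, since its index is eventually
less than `n i`. -/
theorem isPartialIso_ultraRel {idx : L.Symbols → ℕ} {F : I → Set (M × N)} {n : I → ℕ}
    (hF : ∀ i, IsPartialIso (fun s => idx s < n i) (F i)) (hn : Filter.Tendsto n U Filter.atTop) :
    IsPartialIso (L := L) (fun _ => True) (ultraRel U F) where
  eq_iff := by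
    rintro ⟨_, _⟩ ⟨s, t, rfl, rfl, h⟩ ⟨_, _⟩ ⟨s', t', rfl, rfl, h'⟩
    refine mk_eq_mk_iff.trans ((Filter.eventually_congr ?_).trans mk_eq_mk_iff.symm)
    filter_upwards [h, h'] with i hi hi'
    exact (hF i).eq_iff _ hi _ hi'
  funMap_iff := by
    rintro l f - c d hcd ⟨_, _⟩ ⟨s, t, rfl, rfl, h⟩
    choose s' t' hs ht hst using hcd
    obtain rfl : c = fun j => Quotient.mk'' (s' j) := funext hs
    obtain rfl : d = fun j => Quotient.mk'' (t' j) := funext ht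
    have e₁ := Ultraproduct.funMap_cast (M := fun _ : I => M) (u := U) f s'
    have e₂ := Ultraproduct.funMap_cast (M := fun _ : I => N) (u := U) f t'
    refine (Eq.congr_left e₁).trans (Iff.trans ?_ (Eq.congr_left e₂).symm)
    refine mk_eq_mk_iff.trans ((Filter.eventually_congr ?_).trans mk_eq_mk_iff.symm)
    filter_upwards [h, Filter.eventually_all.2 hst, hn.eventually_gt_atTop (idx (.inl ⟨l, f⟩))]
      with i hi hi' hn
    exact (hF i).funMap_iff f hn _ _ hi' _ hi
  relMap_iff := by
    rintro l R - c d hcd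
    choose s' t' hs ht hst using hcd
    obtain rfl : c = fun j => Quotient.mk'' (s' j) := funext hs
    obtain rfl : d = fun j => Quotient.mk'' (t' j) := funext ht
    refine (relMap_mk_iff R s').trans (Iff.trans (Filter.eventually_congr ?_)
      (relMap_mk_iff R t').symm)
    filter_upwards [Filter.eventually_all.2 hst, hn.eventually_gt_atTop (idx (.inr ⟨l, R⟩))]
      with i hi hn
    exact (hF i).relMap_iff R hn _ _ hi

/-- An extension uses up one move at each index. At indices without remaining moves nothing is
required of the answer, and these indices are negligible, since the number of moves tends to
infinity. -/
theorem isBackAndForth_efSystem [Nonempty M] [Nonempty N] (idx : L.Symbols → ℕ) :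
    IsBackAndForth L (efSystem U M N idx) where
  isPartialIso := by
    rintro _ ⟨F, n, k, rfl, hF, hn, hk⟩
    exact isPartialIso_ultraRel (fun i => (hF i).isPartialIso) hn
  forth := by
    rintro _ ⟨F, n, k, rfl, hF, hn, hk⟩ c
    induction c using Quotient.inductionOn' with | h s
    have : ∀ i, ∃ (d : N) (G : Set (M × N)), IsEFEquiv idx (n i) (k i - 1) G ∧ F i ⊆ G ∧
        (0 < k i → (s i, d) ∈ G) := by
      intro i
      have h := hF i
      rcases hki : k i with - | l
      · exact ⟨Classical.arbitrary N, F i, by simpa [hki] using h, subset_rfl,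
          fun h' => absurd h' (by omega)⟩
      · rw [hki] at h
        obtain ⟨d, hd⟩ := h.2.1 (s i)
        exact ⟨d, _, by simpa [hki] using hd, Set.subset_insert _ _, fun _ => Set.mem_insert _ _⟩
    choose t G hG hFG hst using this
    refine ⟨Quotient.mk'' t, ultraRel U G,
      ⟨G, n, _, rfl, hG, hn, (Filter.tendsto_sub_atTop_nat 1).comp hk⟩, ?_, ?_⟩
    · rintro _ ⟨s, t, hs, ht, h⟩
      exact ⟨s, t, hs, ht, h.mono fun i hi => hFG i hi⟩
    · exact ⟨s, t, rfl, rfl, (hk.eventually_gt_atTop 0).mono fun i hi => hst i hi⟩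
  back := by
    rintro _ ⟨F, n, k, rfl, hF, hn, hk⟩ d
    induction d using Quotient.inductionOn' with | h t
    have : ∀ i, ∃ (c : M) (G : Set (M × N)), IsEFEquiv idx (n i) (k i - 1) G ∧ F i ⊆ G ∧
        (0 < k i → (c, t i) ∈ G) := by
      intro i
      have h := hF i
      rcases hki : k i with - | l
      · exact ⟨Classical.arbitrary M, F i, by simpa [hki] using h, subset_rfl,
          fun h' => absurd h' (by omega)⟩
      · rw [hki] at h
        obtain ⟨c, hc⟩ := h.2.2 (t i)
        exact ⟨c, _, by simpa [hki] using hc, Set.subset_insert _ _, fun _ => Set.mem_insert _ _⟩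
    choose s G hG hFG hst using this
    refine ⟨Quotient.mk'' s, ultraRel U G,
      ⟨G, n, _, rfl, hG, hn, (Filter.tendsto_sub_atTop_nat 1).comp hk⟩, ?_, ?_⟩
    · rintro _ ⟨s, t, hs, ht, h⟩
      exact ⟨s, t, hs, ht, h.mono fun i hi => hFG i hi⟩
    · exact ⟨s, t, rfl, rfl, (hk.eventually_gt_atTop 0).mono fun i hi => hst i hi⟩

/-- A set of at most `#I` parameters is covered by finite sets, index by index; winning positions
which contain these finite sets form a member of `efSystem` whose domain contains the parameters. -/
theorem IsSaturated.ultrapower_of_elementarilyEquivalent [Infinite I] [Nonempty M] [Nonempty N]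
    [Countable L.Symbols] (hU : IsRegularUltrafilter U) (hMN : M ≅[L] N)
    (h : IsSaturated L (Order.succ (lift.{y} #I)) (Ultrapower U N)) :
    IsSaturated L (Order.succ (lift.{x} #I)) (Ultrapower U M) := by
  intro A hA
  rw [Order.lt_succ_iff] at hA
  obtain ⟨idx, hidx⟩ := Countable.exists_injective_nat L.Symbols
  obtain ⟨n, hn⟩ := hU.exists_tendsto
  obtain ⟨C, hC, hCA⟩ := hU.exists_finite_cover (X := A) (by simpa using lift_le.{v}.2 hA)
  choose F _ hF hFX using fun i => IsEFEquiv.exists_of_elementarilyEquivalent hidx hMN (n i) (n i)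
    ((hC i).image fun c : A => Quotient.out c.1 i)
  -- the answer to the parameter `c` at the index `i` matters only if `c` is in the finite set `C i`
  have hsel : ∀ c : A, ∃ t : I → N, ∀ᶠ i in (U : Filter I), (Quotient.out c.1 i, t i) ∈ F i := by
    intro c
    have : ∀ i, ∃ d, c ∈ C i → (Quotient.out c.1 i, d) ∈ F i := by
      intro i
      by_cases hc : c ∈ C i
      · obtain ⟨d, hd⟩ := hFX i _ ⟨c, hc, rfl⟩
        exact ⟨d, fun _ => hd⟩
      · exact ⟨Classical.arbitrary N, fun h => absurd h hc⟩
    choose t ht using this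
    exact ⟨t, (hCA c).mono ht⟩
  choose t ht using hsel
  refine (isBackAndForth_efSystem idx).realizesTypesOver (h := fun c => Quotient.mk'' (t c))
    ⟨F, n, n, rfl, hF, hn, hn⟩
    (fun c => ⟨Quotient.out c.1, t c, (Quotient.out_eq' c.1).symm, rfl, ht c⟩) (h _ ?_)
  rw [Order.lt_succ_iff]
  have h₁ := mk_range_le_lift (f := fun c : A => (Quotient.mk'' (t c) : Ultrapower U N))
  have h₂ := lift_le.{max v y}.2 hA
  rw [← lift_le.{max v x}]
  refine h₁.trans (h₂.trans ?_)
  simp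

end Ultrapower

/-! ### Simultaneous definability in two structures -/

section Definability

variable {A : Type x} {B : Type y} [setLang.Structure A] [setLang.Structure B] (j : A → B)
  {α : Type w}

/-- The operations `t` and `t'` are given by the same variable, or `t` is a constant `c` and `t'` is
the constant `j c`. -/
class DefTerm (t : (α → A) → A) (t' : (α → B) → B) : Prop where
  exists_var : ∃ k : A ⊕ α, (∀ e, Sum.elim (fun c => c) e k = t e) ∧ ∀ e, Sum.elim j e k = t' e

/-- A single formula of set theory, with parameters from `A`, defines `P` in `A`, and `Q` in `B`
when the parameters are replaced by their images under `j`. -/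
class DefPair (P : (α → A) → Prop) (Q : (α → B) → Prop) : Prop where
  exists_formula : ∃ φ : setLang.Formula (A ⊕ α),
    (∀ e, φ.Realize (Sum.elim (fun c => c) e) ↔ P e) ∧ ∀ e, φ.Realize (Sum.elim j e) ↔ Q e

instance DefTerm.var (i : α) : DefTerm j (fun e : α → A => e i) (fun e => e i) :=
  ⟨.inr i, fun _ => rfl, fun _ => rfl⟩

instance DefTerm.const (c : A) : DefTerm j (fun _ : α → A => c) (fun _ => j c) :=
  ⟨.inl c, fun _ => rfl, fun _ => rfl⟩

namespace DefPair

variable {P P' : (α → A) → Prop} {Q Q' : (α → B) → Prop}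

instance mem (s t : (α → A) → A) (s' t' : (α → B) → B) [hs : DefTerm j s s'] [ht : DefTerm j t t'] :
    DefPair j (fun e => E (s e) (t e)) (fun e => E (s' e) (t' e)) := by
  obtain ⟨k, hk, hk'⟩ := hs
  obtain ⟨l, hl, hl'⟩ := ht
  refine ⟨Relations.formula₂ memSym (.var k) (.var l), fun e => ?_, fun e => ?_⟩
  · simp [E, Formula.realize_rel₂, hk, hl]
  · simp [E, Formula.realize_rel₂, hk', hl']

instance eq (s t : (α → A) → A) (s' t' : (α → B) → B) [hs : DefTerm j s s'] [ht : DefTerm j t t'] :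
    DefPair j (fun e => s e = t e) (fun e => s' e = t' e) := by
  obtain ⟨k, hk, hk'⟩ := hs
  obtain ⟨l, hl, hl'⟩ := ht
  refine ⟨Term.equal (.var k) (.var l), fun e => ?_, fun e => ?_⟩
  · simp [hk, hl]
  · simp [hk', hl']

instance and [h : DefPair j P Q] [h' : DefPair j P' Q'] :
    DefPair j (fun e => P e ∧ P' e) (fun e => Q e ∧ Q' e) := by
  obtain ⟨φ, h₁, h₂⟩ := h
  obtain ⟨ψ, h₁', h₂'⟩ := h'
  exact ⟨φ ⊓ ψ, by simp [Formula.realize_inf, *], by simp [Formula.realize_inf, *]⟩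

instance or [h : DefPair j P Q] [h' : DefPair j P' Q'] :
    DefPair j (fun e => P e ∨ P' e) (fun e => Q e ∨ Q' e) := by
  obtain ⟨φ, h₁, h₂⟩ := h
  obtain ⟨ψ, h₁', h₂'⟩ := h'
  exact ⟨φ ⊔ ψ, by simp [Formula.realize_sup, *], by simp [Formula.realize_sup, *]⟩

instance imp [h : DefPair j P Q] [h' : DefPair j P' Q'] :
    DefPair j (fun e => P e → P' e) (fun e => Q e → Q' e) := by
  obtain ⟨φ, h₁, h₂⟩ := h
  obtain ⟨ψ, h₁', h₂'⟩ := h'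
  exact ⟨Formula.imp φ ψ, by simp [Formula.realize_imp, *], by simp [Formula.realize_imp, *]⟩

instance iff [h : DefPair j P Q] [h' : DefPair j P' Q'] :
    DefPair j (fun e => P e ↔ P' e) (fun e => Q e ↔ Q' e) := by
  obtain ⟨φ, h₁, h₂⟩ := h
  obtain ⟨ψ, h₁', h₂'⟩ := h'
  exact ⟨Formula.iff φ ψ, by simp [Formula.realize_iff, *], by simp [Formula.realize_iff, *]⟩

instance not [h : DefPair j P Q] : DefPair j (fun e => ¬ P e) (fun e => ¬ Q e) := by
  obtain ⟨φ, h₁, h₂⟩ := h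
  exact ⟨Formula.not φ, by simp [Formula.realize_not, *], by simp [Formula.realize_not, *]⟩

/-- The variable `none` becomes the variable to be quantified. -/
def quantVar {K : Type y} : K ⊕ Option α → (K ⊕ α) ⊕ Fin 1 :=
  Sum.elim (fun c => .inl (.inl c)) fun o => o.elim (.inr 0) fun i => .inl (.inr i)

theorem elim_comp_quantVar {K : Type y} {C : Type x} (f : K → C) (e : α → C) (c : Fin 1 → C) :
    Sum.elim (Sum.elim f e) c ∘ quantVar = Sum.elim f fun o => o.elim (c 0) e := by
  funext k
  rcases k with k | _ | k <;> rfl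

instance ex {P : (α → A) → A → Prop} {Q : (α → B) → B → Prop}
    [h : DefPair j (fun e : Option α → A => P (fun i => e (some i)) (e none))
      (fun e : Option α → B => Q (fun i => e (some i)) (e none))] :
    DefPair j (fun e => ∃ c, P e c) (fun e => ∃ c, Q e c) := by
  obtain ⟨φ, h₁, h₂⟩ := h
  refine ⟨Formula.iExs (Fin 1) (Formula.relabel quantVar φ), fun e => ?_, fun e => ?_⟩
  · simp only [Formula.realize_iExs, Formula.realize_relabel, elim_comp_quantVar, h₁]
    exact ⟨fun ⟨c, hc⟩ => ⟨c 0, hc⟩, fun ⟨c, hc⟩ => ⟨fun _ => c, hc⟩⟩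
  · simp only [Formula.realize_iExs, Formula.realize_relabel, elim_comp_quantVar, h₂]
    exact ⟨fun ⟨c, hc⟩ => ⟨c 0, hc⟩, fun ⟨c, hc⟩ => ⟨fun _ => c, hc⟩⟩

instance all {P : (α → A) → A → Prop} {Q : (α → B) → B → Prop}
    [h : DefPair j (fun e : Option α → A => P (fun i => e (some i)) (e none))
      (fun e : Option α → B => Q (fun i => e (some i)) (e none))] :
    DefPair j (fun e => ∀ c, P e c) (fun e => ∀ c, Q e c) := by
  have h' : DefPair j (fun e : α → A => ¬ ∃ c, ¬ P e c) (fun e => ¬ ∃ c, ¬ Q e c) := inferInstance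
  simpa only [not_exists, not_not] using h'

instance exUnique {P : (α → A) → A → Prop} {Q : (α → B) → B → Prop}
    [h : DefPair j (fun e => ∃ c, P e c ∧ ∀ d, P e d → d = c)
      (fun e => ∃ c, Q e c ∧ ∀ d, Q e d → d = c)] :
    DefPair j (fun e => ∃! c, P e c) (fun e => ∃! c, Q e c) := h

/-- A definition of a relation between variables yields definitions of its instances; it suffices to
unfold a set-theoretic notion once, for distinct variables. -/
theorem subst {n : ℕ} {P : (Fin n → A) → Prop} {Q : (Fin n → B) → Prop} (h : DefPair j P Q)
    {t : Fin n → (α → A) → A} {t' : Fin n → (α → B) → B} (ht : ∀ i, DefTerm j (t i) (t' i)) :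
    DefPair j (fun e => P fun i => t i e) (fun e => Q fun i => t' i e) := by
  obtain ⟨φ, h₁, h₂⟩ := h
  choose k hk hk' using fun i => (ht i).exists_var
  refine ⟨Formula.relabel (Sum.elim .inl k) φ, fun e => ?_, fun e => ?_⟩
  · rw [Formula.realize_relabel, ← h₁]
    refine iff_of_eq (congrArg _ ?_)
    funext l
    rcases l with l | l
    exacts [rfl, hk l e]
  · rw [Formula.realize_relabel, ← h₂]
    refine iff_of_eq (congrArg _ ?_)
    funext l
    rcases l with l | l
    exacts [rfl, hk' l e]

theorem subst₁ {P : A → Prop} {Q : B → Prop}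
    (h : DefPair j (fun e : Fin 1 → A => P (e 0)) fun e => Q (e 0))
    (s : (α → A) → A) (s' : (α → B) → B) [hs : DefTerm j s s'] :
    DefPair j (fun e => P (s e)) fun e => Q (s' e) :=
  h.subst j (t := ![s]) (t' := ![s']) (by simpa [Fin.forall_fin_succ] using hs)

theorem subst₂ {P : A → A → Prop} {Q : B → B → Prop}
    (h : DefPair j (fun e : Fin 2 → A => P (e 0) (e 1)) fun e => Q (e 0) (e 1))
    (s t : (α → A) → A) (s' t' : (α → B) → B) [hs : DefTerm j s s'] [ht : DefTerm j t t'] :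
    DefPair j (fun e => P (s e) (t e)) fun e => Q (s' e) (t' e) :=
  h.subst j (t := ![s, t]) (t' := ![s', t']) (by simpa [Fin.forall_fin_succ] using ⟨hs, ht⟩)

theorem subst₃ {P : A → A → A → Prop} {Q : B → B → B → Prop}
    (h : DefPair j (fun e : Fin 3 → A => P (e 0) (e 1) (e 2)) fun e => Q (e 0) (e 1) (e 2))
    (s t r : (α → A) → A) (s' t' r' : (α → B) → B) [hs : DefTerm j s s'] [ht : DefTerm j t t']
    [hr : DefTerm j r r'] :
    DefPair j (fun e => P (s e) (t e) (r e)) fun e => Q (s' e) (t' e) (r' e) :=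
  h.subst j (t := ![s, t, r]) (t' := ![s', t', r'])
    (by simpa [Fin.forall_fin_succ] using ⟨hs, ht, hr⟩)

instance isPair (s t r : (α → A) → A) (s' t' r' : (α → B) → B) [DefTerm j s s'] [DefTerm j t t']
    [DefTerm j r r'] :
    DefPair j (fun e => IsPair (s e) (t e) (r e)) fun e => IsPair (s' e) (t' e) (r' e) :=
  subst₃ j (by unfold IsPair; infer_instance) s t r s' t' r'

instance related (s t r : (α → A) → A) (s' t' r' : (α → B) → B) [DefTerm j s s'] [DefTerm j t t']
    [DefTerm j r r'] :
    DefPair j (fun e => Related (s e) (t e) (r e)) fun e => Related (s' e) (t' e) (r' e) :=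
  subst₃ j (by unfold Related; infer_instance) s t r s' t' r'

instance isInductiveSet (s : (α → A) → A) (s' : (α → B) → B) [DefTerm j s s'] :
    DefPair j (fun e => IsInductiveSet (s e)) fun e => IsInductiveSet (s' e) :=
  subst₁ j (by unfold IsInductiveSet; infer_instance) s s'

instance isNatural (s : (α → A) → A) (s' : (α → B) → B) [DefTerm j s s'] :
    DefPair j (fun e => IsNatural (s e)) fun e => IsNatural (s' e) :=
  subst₁ j (by unfold IsNatural; infer_instance) s s'

instance isBijection (s t r : (α → A) → A) (s' t' r' : (α → B) → B) [DefTerm j s s']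
    [DefTerm j t t'] [DefTerm j r r'] :
    DefPair j (fun e => IsBijection (s e) (t e) (r e)) fun e => IsBijection (s' e) (t' e) (r' e) :=
  subst₃ j (by unfold IsBijection; infer_instance) s t r s' t' r'

instance isInternallyFinite (s : (α → A) → A) (s' : (α → B) → B) [DefTerm j s s'] :
    DefPair j (fun e => IsInternallyFinite (s e)) fun e => IsInternallyFinite (s' e) :=
  subst₁ j (by unfold IsInternallyFinite; infer_instance) s s'

end DefPair

/-- Elementarity, for statements with parameters: `Q` is the statement `P` about the images of the
parameters. The formula expressing `P` is found by instance search. -/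
theorem transfer (j : A ↪ₑ[setLang] B) {P Q : Prop}
    [h : DefPair j (fun _ : Empty → A => P) (fun _ => Q)] : P ↔ Q := by
  obtain ⟨φ, h₁, h₂⟩ := h
  rw [← h₁ Empty.elim, ← h₂ Empty.elim, ← j.map_formula φ]
  refine iff_of_eq (congrArg _ ?_)
  funext k
  rcases k with k | k
  exacts [rfl, k.elim]

/-- Łoś's theorem for a definable property of one element of the ultrapower. -/
theorem ultrapower_iff {I : Type v} (U : Ultrafilter I) [Nonempty A] {P : A → Prop}
    {Q : Ultrapower U A → Prop} (j : A → Ultrapower U A) (hj : ∀ c, j c = Quotient.mk'' fun _ => c)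
    (h : DefPair j (fun e : Unit → A => P (e ())) (fun e => Q (e ()))) (s : I → A) :
    Q (Quotient.mk'' s) ↔ ∀ᶠ i in (U : Filter I), P (s i) := by
  obtain ⟨φ, h₁, h₂⟩ := h
  have := Ultraproduct.realize_formula_cast (M := fun _ : I => A) (u := U) φ
    (Sum.elim (fun c _ => c) fun _ => s)
  refine ((h₂ fun _ => Quotient.mk'' s).symm.trans ?_).trans (this.trans ?_)
  · refine iff_of_eq (congrArg _ ?_)
    funext k
    rcases k with k | k
    exacts [hj k, rfl]
  · refine Filter.eventually_congr (Filter.Eventually.of_forall fun i => ?_)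
    rw [← h₁ fun _ => s i]
    refine iff_of_eq (congrArg _ ?_)
    funext k
    rcases k with k | k <;> rfl

/-- A formula with finitely many free variables and parameters, in the form which the schemes of
`ZFC⁻` use. -/
theorem exists_boundedFormula [Nonempty A] {m : ℕ} (φ : setLang.Formula (A ⊕ Fin m)) :
    ∃ (ψ : setLang.BoundedFormula ℕ m) (e : ℕ → A), ∀ c : Fin m → A,
      ψ.Realize e c ↔ φ.Realize (Sum.elim (fun d => d) c) := by
  classical
  let S := BoundedFormula.freeVarFinset φ
  let f : S → ℕ ⊕ Fin m := fun k => Sum.elim (fun _ => .inl (S.equivFin k)) .inr k.1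
  -- `e` lists the finitely many parameters of `φ`; the values at the other variables are irrelevant
  let e : ℕ → A := fun n => if h : n < S.card then
    Sum.elim (fun d => d) (fun _ => Classical.arbitrary A) (S.equivFin.symm ⟨n, h⟩).1 else
      Classical.arbitrary A
  refine ⟨BoundedFormula.relabel (k := 0) (n := m) id (φ.restrictFreeVar f), e, fun c => ?_⟩
  rw [BoundedFormula.realize_relabel]
  refine (BoundedFormula.realize_restrictFreeVar (Sum.elim (fun d => d) c) ?_).trans
    (iff_of_eq (congrArg _ (Subsingleton.elim _ _)))
  rintro ⟨k | k, hk⟩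
  · simp [f, e]
  · simp [f]

/-- The separation scheme for a property of the model, with a definition found by instance search.
-/
theorem ModelsZFCMinus.exists_sep (hZ : ModelsZFCMinus A) (P : A → Prop)
    [h : DefPair (fun c : A => c) (fun e : Fin 1 → A => P (e 0)) (fun e => P (e 0))] (s : A) :
    ∃ t : A, ∀ r, E r t ↔ E r s ∧ P r := by
  have := hZ.nonempty
  obtain ⟨φ, h₁, -⟩ := h
  obtain ⟨ψ, e, hψ⟩ := exists_boundedFormula φ
  obtain ⟨t, ht⟩ := hZ.separation ψ e s
  refine ⟨t, fun r => (ht r).trans (and_congr_right fun _ => ?_)⟩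
  rw [hψ, h₁]
  rfl

/-- The collection scheme for a relation on the model, with a definition found by instance search.
-/
theorem ModelsZFCMinus.exists_collection (hZ : ModelsZFCMinus A) (R : A → A → Prop)
    [h : DefPair (fun c : A => c) (fun e : Fin 2 → A => R (e 0) (e 1)) (fun e => R (e 0) (e 1))]
    (s : A) (hs : ∀ r, E r s → ∃ q, R r q) :
    ∃ t : A, ∀ r, E r s → ∃ q, E q t ∧ R r q := by
  have := hZ.nonempty
  obtain ⟨φ, h₁, -⟩ := h
  obtain ⟨ψ, e, hψ⟩ := exists_boundedFormula φ
  have key : ∀ r q, ψ.Realize e ![r, q] ↔ R r q := fun r q => by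
    rw [hψ, h₁]
    rfl
  simpa only [key] using hZ.collection ψ e s (by simpa only [key] using hs)

end Definability

/-! ### Transitive models of `ZFC⁻` -/

theorem succ_injective {s t : ZFSet.{u}} (h : insert s s = insert t t) : s = t := by
  by_contra hne
  have h₁ : s ∈ insert t t := h ▸ ZFSet.mem_insert s s
  have h₂ : t ∈ insert s s := h ▸ ZFSet.mem_insert t t
  rw [ZFSet.mem_insert_iff] at h₁ h₂
  exact ZFSet.mem_asymm (h₁.resolve_left hne) (h₂.resolve_left (Ne.symm hne))

theorem mem_numeral_iff {k : ℕ} {s : ZFSet.{u}} : s ∈ numeral k ↔ ∃ l < k, s = numeral l := by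
  induction k with
  | zero => simp [numeral]
  | succ k ih =>
    rw [numeral, ZFSet.mem_insert_iff, ih]
    constructor
    · rintro (rfl | ⟨l, hl, rfl⟩)
      exacts [⟨k, by omega, rfl⟩, ⟨l, by omega, rfl⟩]
    · rintro ⟨l, hl, rfl⟩
      rcases Nat.lt_succ_iff_lt_or_eq.1 hl with h | rfl
      exacts [Or.inr ⟨l, h, rfl⟩, Or.inl rfl]

theorem numeral_injective : Function.Injective (numeral : ℕ → ZFSet.{u}) := by
  have key : ∀ k l : ℕ, k < l → (numeral k : ZFSet.{u}) ≠ numeral l := by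
    intro k l hkl h
    have hm : (numeral k : ZFSet.{u}) ∈ numeral l := mem_numeral_iff.2 ⟨k, hkl, rfl⟩
    rw [h] at hm
    exact ZFSet.mem_irrefl _ hm
  intro k l h
  by_contra hne
  rcases Nat.lt_or_gt_of_ne hne with hlt | hlt
  exacts [key _ _ hlt h, key _ _ hlt h.symm]

theorem numeral_mem_numeral_iff {k l : ℕ} : (numeral k : ZFSet.{u}) ∈ numeral l ↔ k < l :=
  mem_numeral_iff.trans ⟨fun ⟨_, h, e⟩ => numeral_injective e ▸ h, fun h => ⟨k, h, rfl⟩⟩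

theorem tuple_inj {m n : ℕ} {f : Fin m → ZFSet.{u}} {g : Fin n → ZFSet.{u}}
    (h : tuple f = tuple g) : ∃ e : m = n, f = g ∘ Fin.cast e := by
  induction m generalizing n with
  | zero =>
    cases n with
    | zero => exact ⟨rfl, funext fun i => i.elim0⟩
    | succ n =>
      have h' : ∅ = ZFSet.pair (g 0) (tuple (Fin.tail g)) := h
      exact absurd (h'.symm ▸ (by simp [ZFSet.pair] : {g 0} ∈ ZFSet.pair (g 0) _))
        (ZFSet.notMem_empty _)
  | succ m ih =>
    cases n with
    | zero =>
      have h' : ∅ = ZFSet.pair (f 0) (tuple (Fin.tail f)) := h.symm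
      exact absurd (h'.symm ▸ (by simp [ZFSet.pair] : {f 0} ∈ ZFSet.pair (f 0) _))
        (ZFSet.notMem_empty _)
    | succ n =>
      have h' : ZFSet.pair (f 0) (tuple (Fin.tail f)) = ZFSet.pair (g 0) (tuple (Fin.tail g)) := h
      obtain ⟨h₀, ht⟩ := ZFSet.pair_inj.1 h'
      obtain ⟨rfl, ht⟩ := ih ht
      refine ⟨rfl, funext fun i => Fin.cases h₀ (fun i => congrFun ht i) i⟩

section Transitive

variable {V : Set ZFSet.{u}} (hV : IsTransitiveClass V)

include hV

theorem ext_of_transitive {s t : V} (h : ∀ r, E r s ↔ E r t) : s = t := by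
  refine Subtype.ext (ZFSet.ext fun r => ⟨fun hr => ?_, fun hr => ?_⟩)
  · exact (h ⟨r, hV _ s.2 _ hr⟩).1 hr
  · exact (h ⟨r, hV _ t.2 _ hr⟩).2 hr

theorem eq_of_forall_mem_iff {s : V} {t : ZFSet.{u}} (ht : ∀ r ∈ t, r ∈ V)
    (h : ∀ r : V, E r s ↔ r.1 ∈ t) : s.1 = t := by
  refine ZFSet.ext fun r => ⟨fun hr => ?_, fun hr => ?_⟩
  · exact (h ⟨r, hV _ s.2 _ hr⟩).1 hr
  · exact (h ⟨r, ht _ hr⟩).2 hr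

theorem forall_not_mem_iff {s : V} : (∀ r, ¬ E r s) ↔ s.1 = ∅ := by
  refine ⟨fun h => eq_of_forall_mem_iff hV (by simp) fun r => ?_, fun h r => ?_⟩
  · simpa using h r
  · rw [E_iff, h]
    exact ZFSet.notMem_empty _

variable (hZ : ModelsZFCMinus V)

include hZ

theorem unordered_pair_mem {s t : ZFSet.{u}} (hs : s ∈ V) (ht : t ∈ V) :
    ({s, t} : ZFSet.{u}) ∈ V := by
  obtain ⟨p, hp⟩ := hZ.pairing ⟨s, hs⟩ ⟨t, ht⟩
  have : p.1 = {s, t} := by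
    refine eq_of_forall_mem_iff hV ?_ fun r => ?_
    · intro r hr
      rcases ZFSet.mem_pair.1 hr with rfl | rfl <;> assumption
    · rw [hp, ZFSet.mem_pair, Subtype.ext_iff, Subtype.ext_iff]
  exact this ▸ p.2

theorem singleton_mem {s : ZFSet.{u}} (hs : s ∈ V) : ({s} : ZFSet.{u}) ∈ V := by
  have := unordered_pair_mem hV hZ hs hs
  rwa [ZFSet.pair_eq_singleton] at this

theorem pair_mem {s t : ZFSet.{u}} (hs : s ∈ V) (ht : t ∈ V) : ZFSet.pair s t ∈ V :=
  unordered_pair_mem hV hZ (singleton_mem hV hZ hs) (unordered_pair_mem hV hZ hs ht)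

theorem sUnion_mem {s : ZFSet.{u}} (hs : s ∈ V) : (ZFSet.sUnion s) ∈ V := by
  obtain ⟨t, ht⟩ := hZ.union ⟨s, hs⟩
  have : t.1 = ZFSet.sUnion s := by
    refine eq_of_forall_mem_iff hV ?_ fun r => ?_
    · intro r hr
      obtain ⟨q, hq, hr⟩ := ZFSet.mem_sUnion.1 hr
      exact hV _ (hV _ hs _ hq) _ hr
    · rw [ht, ZFSet.mem_sUnion]
      exact ⟨fun ⟨q, hq, hr⟩ => ⟨q.1, hq, hr⟩, fun ⟨q, hq, hr⟩ => ⟨⟨q, hV _ hs _ hq⟩, hq, hr⟩⟩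
  exact this ▸ t.2

theorem union_mem {s t : ZFSet.{u}} (hs : s ∈ V) (ht : t ∈ V) : s ∪ t ∈ V :=
  sUnion_mem hV hZ (unordered_pair_mem hV hZ hs ht)

theorem insert_mem {s t : ZFSet.{u}} (hs : s ∈ V) (ht : t ∈ V) : insert s t ∈ V := by
  rw [ZFSet.insert_eq]
  exact union_mem hV hZ (singleton_mem hV hZ hs) ht

theorem empty_mem : (∅ : ZFSet.{u}) ∈ V := by
  obtain ⟨s, ⟨e, -, he⟩, -⟩ := hZ.infinity
  exact (forall_not_mem_iff hV).1 he ▸ e.2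

theorem numeral_mem (k : ℕ) : (numeral k : ZFSet.{u}) ∈ V := by
  induction k with
  | zero => exact empty_mem hV hZ
  | succ k ih => exact insert_mem hV hZ ih ih

theorem exists_mem_iff_of_finite {X : Set ZFSet.{u}} (hX : X.Finite) (hXV : X ⊆ V) :
    ∃ s ∈ V, ∀ r, r ∈ s ↔ r ∈ X := by
  induction X, hX using Set.Finite.induction_on with
  | empty => exact ⟨∅, empty_mem hV hZ, by simp⟩
  | @insert c X _ _ ih =>
    obtain ⟨s, hs, h⟩ := ih ((Set.subset_insert _ _).trans hXV)
    exact ⟨insert c s, insert_mem hV hZ (hXV (Set.mem_insert _ _)) hs, by simp [h]⟩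

theorem isPair_iff {s t p : V} : IsPair s t p ↔ p.1 = ZFSet.pair s.1 t.1 := by
  refine ⟨fun h => ?_, isPair_pair hV⟩
  have h' : IsPair s t ⟨_, pair_mem hV hZ s.2 t.2⟩ := isPair_pair hV rfl
  exact congrArg Subtype.val (ext_of_transitive hV fun z => (h z).trans (h' z).symm)

theorem related_iff {r s t : V} : Related r s t ↔ ZFSet.pair s.1 t.1 ∈ r.1 := by
  refine ⟨fun ⟨p, hp, h⟩ => (isPair_iff hV hZ).1 hp ▸ h, fun h => ?_⟩
  exact ⟨⟨_, hV _ r.2 _ h⟩, isPair_pair hV rfl, h⟩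

theorem isSucc_iff {m n : V} : (∀ r, E r m ↔ E r n ∨ r = n) ↔ m.1 = insert n.1 n.1 := by
  refine ⟨fun h => eq_of_forall_mem_iff hV ?_ fun r => ?_, fun h r => ?_⟩
  · exact hV _ (insert_mem hV hZ n.2 n.2)
  · rw [h, ZFSet.mem_insert_iff, Subtype.ext_iff, or_comm, E_iff]
  · rw [E_iff, h, ZFSet.mem_insert_iff, Subtype.ext_iff, or_comm, E_iff]

theorem isNatural_succ {m n : V} (hn : IsNatural n) (h : m.1 = insert n.1 n.1) : IsNatural m := by
  intro s hs
  obtain ⟨m', hm', h'⟩ := hs.2 n (hn s hs)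
  have : m = m' := Subtype.ext (h.trans ((isSucc_iff hV hZ).1 h').symm)
  exact this ▸ hm'

/-- The natural numbers of a transitive model are the true ones: a natural number of the model which
is not a numeral, and is minimal with this property, could be removed from an inductive set. -/
theorem isNatural_iff {n : V} : IsNatural n ↔ ∃ k, n.1 = numeral k := by
  constructor
  · suffices H : ∀ (s : ZFSet.{u}) (hs : s ∈ V), IsNatural (⟨s, hs⟩ : V) → ∃ k, s = numeral k from
      H n.1 n.2
    intro s
    induction s using ZFSet.inductionOn with | h s ih
    intro hs hnat
    by_contra hno
    obtain ⟨a, ha⟩ := hZ.infinity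
    obtain ⟨t, ht⟩ := hZ.exists_sep (fun c => IsNatural c ∧ ¬ c = ⟨s, hs⟩) a
    have hmem : E (⟨s, hs⟩ : V) t := hnat t ⟨?_, ?_⟩
    · exact ((ht _).1 hmem).2.2 rfl
    · obtain ⟨e, he, he'⟩ := ha.1
      have he₀ : e.1 = ∅ := (forall_not_mem_iff hV).1 he'
      refine ⟨e, (ht e).2 ⟨he, fun b hb => ?_, fun h => hno ⟨0, ?_⟩⟩, he'⟩
      · obtain ⟨e', hb', he''⟩ := hb.1
        have : e = e' := Subtype.ext (he₀.trans ((forall_not_mem_iff hV).1 he'').symm)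
        exact this ▸ hb'
      · exact (congrArg Subtype.val h).symm.trans he₀
    · intro c hc
      obtain ⟨hca, hcn, -⟩ := (ht c).1 hc
      obtain ⟨m, hm, hmc⟩ := ha.2 c hca
      have hmc' := (isSucc_iff hV hZ).1 hmc
      refine ⟨m, (ht m).2 ⟨hm, isNatural_succ hV hZ hcn hmc', fun h => ?_⟩, hmc⟩
      have hs' : s = insert c.1 c.1 := (congrArg Subtype.val h).symm.trans hmc'
      obtain ⟨k, hk⟩ := ih c.1 (hs' ▸ ZFSet.mem_insert _ _) c.2 hcn
      exact hno ⟨k + 1, by rw [hs', hk]; rfl⟩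
  · rintro ⟨k, hk⟩
    induction k generalizing n with
    | zero =>
      intro s hs
      obtain ⟨e, he, he'⟩ := hs.1
      have : n = e := Subtype.ext (hk.trans ((forall_not_mem_iff hV).1 he').symm)
      exact this ▸ he
    | succ k ih => exact isNatural_succ hV hZ (n := ⟨_, numeral_mem hV hZ k⟩) (ih rfl) hk

/-- Finiteness is absolute: the natural numbers of the model are standard, and the model contains
the graphs of all bijections between its finite subsets and the numerals. -/
theorem isInternallyFinite_iff {s : V} :
    IsInternallyFinite s ↔ {r : ZFSet.{u} | r ∈ s.1}.Finite := by
  constructor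
  · rintro ⟨n, f, hn, hf⟩
    obtain ⟨k, hk⟩ := (isNatural_iff hV hZ).1 hn
    have hfin : {r : ZFSet.{u} | r ∈ n.1}.Finite := by
      refine (Set.finite_range fun i : Fin k => (numeral i : ZFSet.{u})).subset fun r hr => ?_
      obtain ⟨l, hl, rfl⟩ := mem_numeral_iff.1 (hk ▸ hr : r ∈ numeral k)
      exact ⟨⟨l, hl⟩, rfl⟩
    have hmem : ∀ {c d : V}, Related f c d → E c n := by
      rintro c d hcd
      obtain ⟨c', d', hc', -, hp⟩ := hf.1 ⟨_, hV _ f.2 _ ((related_iff hV hZ).1 hcd)⟩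
        ((related_iff hV hZ).1 hcd)
      have := (ZFSet.pair_inj.1 ((isPair_iff hV hZ).1 hp)).1
      exact (Subtype.ext this : c = c') ▸ hc'
    have hd : ∀ d : {r : ZFSet.{u} | r ∈ s.1}, ∃ c, Related f c ⟨d.1, hV _ s.2 _ d.2⟩ :=
      fun d => (hf.2.2 ⟨d.1, hV _ s.2 _ d.2⟩ d.2).exists
    choose c hc using hd
    have : Finite {r : ZFSet.{u} | r ∈ n.1} := hfin
    have : Finite {r : ZFSet.{u} | r ∈ s.1} := Finite.of_injective
      (fun d => (⟨(c d).1, hmem (hc d)⟩ : {r : ZFSet.{u} | r ∈ n.1})) fun d d' hdd => by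
        have h₀ := congrArg Subtype.val hdd
        have h' : c d = c d' := Subtype.ext h₀
        have h₁ := hc d
        rw [h'] at h₁
        have := (hf.2.1 _ (hmem h₁)).unique h₁ (hc d')
        have := congrArg Subtype.val this
        exact Subtype.ext this
    exact Set.toFinite _
  · intro hfin
    have : Finite {r : ZFSet.{u} | r ∈ s.1} := hfin
    obtain ⟨k, ⟨e⟩⟩ := Finite.exists_equiv_fin {r : ZFSet.{u} | r ∈ s.1}
    let p : {r : ZFSet.{u} | r ∈ s.1} → ZFSet.{u} := fun r => ZFSet.pair (numeral (e r)) r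
    obtain ⟨f, hfV, hf⟩ := exists_mem_iff_of_finite hV hZ (Set.finite_range p) (by
      rintro _ ⟨r, rfl⟩
      exact pair_mem hV hZ (numeral_mem hV hZ _) (hV _ s.2 _ r.2))
    have hrel : ∀ c d : V, Related ⟨f, hfV⟩ c d ↔
        ∃ h : d.1 ∈ s.1, c.1 = numeral (e ⟨d.1, h⟩) := by
      intro c d
      rw [related_iff hV hZ, hf]
      constructor
      · rintro ⟨r, hr⟩
        obtain ⟨h₁, h₂⟩ := ZFSet.pair_inj.1 hr
        exact ⟨h₂ ▸ r.2, by rw [← h₁]; simp [← h₂]⟩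
      · rintro ⟨h, hc⟩
        exact ⟨⟨d.1, h⟩, by rw [hc]⟩
    refine ⟨⟨_, numeral_mem hV hZ k⟩, ⟨f, hfV⟩, (isNatural_iff hV hZ).2 ⟨k, rfl⟩, ?_, ?_, ?_⟩
    · intro q hq
      obtain ⟨r, hr⟩ := (hf q.1).1 hq
      exact ⟨⟨_, numeral_mem hV hZ (e r)⟩, ⟨r.1, hV _ s.2 _ r.2⟩,
        numeral_mem_numeral_iff.2 (e r).2, r.2, isPair_pair hV hr.symm⟩
    · intro c hc
      obtain ⟨l, hl, hcl⟩ := mem_numeral_iff.1 hc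
      have hcl : c.1 = numeral l := hcl
      let r := e.symm ⟨l, hl⟩
      refine ⟨⟨r.1, hV _ s.2 _ r.2⟩, (hrel _ _).2 ⟨r.2, by simp [r, hcl]⟩, fun d hd => ?_⟩
      obtain ⟨h, hd'⟩ := (hrel _ _).1 hd
      have : e ⟨d.1, h⟩ = ⟨l, hl⟩ := Fin.ext (numeral_injective (hd'.symm.trans hcl))
      have := congrArg Subtype.val ((Equiv.eq_symm_apply e).2 this)
      exact Subtype.ext this
    · intro d hd
      refine ⟨⟨_, numeral_mem hV hZ (e ⟨d.1, hd⟩)⟩, (hrel _ _).2 ⟨hd, rfl⟩, fun c hc => ?_⟩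
      obtain ⟨h, hc'⟩ := (hrel _ _).1 hc
      exact Subtype.ext hc'

end Transitive

/-! ### Internal game systems -/

section Internal

variable {A : Type w} [setLang.Structure A]

/-- `H` is a set of pairs `(z, z')` such that `z` and `z'` are tuples of the same length whose
corresponding entries are related by `f`. The length need not be mentioned, since `H` is required to
contain the pairs of tails, and the membership relation is well-founded. -/
def IsTupleRel (H f : A) : Prop :=
  ∀ p, E p H → ∃ z z', IsPair z z' p ∧ (((∀ r, ¬ E r z) ∧ ∀ r, ¬ E r z') ∨
    ∃ c d q q', Related f c d ∧ Related H q q' ∧ IsPair c q z ∧ IsPair d q' z')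

/-- According to the code `l` of a language, `s` is a symbol of kind `k` with index in `n`. -/
def IsSymbol (l n s k : A) : Prop :=
  ∃ t₀ t₁ t₂ t₃ m i, E t₀ l ∧ E i n ∧ IsPair s t₁ t₀ ∧ IsPair k t₂ t₁ ∧ IsPair m t₃ t₂ ∧
    ∃ t₄, IsPair i t₄ t₃

/-- `f` respects equality and the symbols with index in `n`; the interpretations of the symbols are
given by the functions `F` and `F'`. An empty kind is that of the function symbols, for which the
kind is coded by `0`. -/
def IsInternalIso (l F F' n f : A) : Prop :=
  (∀ c d c' d', Related f c d → Related f c' d' → (c = c' ↔ d = d')) ∧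
    ∀ H, IsTupleRel H f → ∀ z z', Related H z z' →
      ∀ s k R R', IsSymbol l n s k → Related F s R → Related F' s R' →
        ((∀ r, ¬ E r k) → ∀ c d, Related f c d → (Related R z c ↔ Related R' z' d)) ∧
          ((∃ r, E r k) → (E z R ↔ E z' R'))

/-- `S` is a set of pairs `(i, f)`, where `f` is a partial isomorphism between the structures with
domains `D` and `D'`, and where `f` has all the back-and-forth extensions `g` with `(i - 1, g)` in
`S`, unless `i` is not a successor. -/
def IsGameSystem (l D F D' F' n S : A) : Prop :=
  ∀ p, E p S → ∃ i f, IsPair i f p ∧ IsInternalIso l F F' n f ∧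
    ∀ i', (∀ r, E r i ↔ E r i' ∨ r = i') →
      (∀ c, E c D → ∃ d g, E d D' ∧ (∀ q, E q f → E q g) ∧ Related g c d ∧ Related S i' g) ∧
      ∀ d, E d D' → ∃ c g, E c D ∧ (∀ q, E q f → E q g) ∧ Related g c d ∧ Related S i' g

/-- For each natural number `n` and each finite `X`, there is a game system in which some position
with `n` remaining moves has a domain which covers the part of `X` in `D`. -/
def HasGameSystems (l D F D' F' : A) : Prop :=
  ∀ n X, IsNatural n → IsInternallyFinite X → ∃ S f Y, IsGameSystem l D F D' F' n S ∧
    Related S n f ∧ IsInternallyFinite Y ∧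
    (∀ c, E c X → E c D → ∃ d, E d D' ∧ Related f c d) ∧ ∀ c d, Related f c d → E d Y

end Internal

section Definability

variable {A : Type x} {B : Type y} [setLang.Structure A] [setLang.Structure B] (j : A → B)
  {α : Type w}

namespace DefPair

instance isTupleRel (s t : (α → A) → A) (s' t' : (α → B) → B) [hs : DefTerm j s s']
    [ht : DefTerm j t t'] :
    DefPair j (fun e => IsTupleRel (s e) (t e)) fun e => IsTupleRel (s' e) (t' e) :=
  subst₂ j (by unfold IsTupleRel; infer_instance) s t s' t'

instance isSymbol (s t r q : (α → A) → A) (s' t' r' q' : (α → B) → B) [hs : DefTerm j s s']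
    [ht : DefTerm j t t'] [hr : DefTerm j r r'] [hq : DefTerm j q q'] :
    DefPair j (fun e => IsSymbol (s e) (t e) (r e) (q e))
      fun e => IsSymbol (s' e) (t' e) (r' e) (q' e) :=
  subst j (P := fun e => IsSymbol (e 0) (e 1) (e 2) (e 3))
    (Q := fun e => IsSymbol (e 0) (e 1) (e 2) (e 3)) (by unfold IsSymbol; infer_instance)
    (t := ![s, t, r, q]) (t' := ![s', t', r', q'])
    (by simpa [Fin.forall_fin_succ] using ⟨hs, ht, hr, hq⟩)

instance isInternalIso (s t r q p : (α → A) → A) (s' t' r' q' p' : (α → B) → B)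
    [hs : DefTerm j s s'] [ht : DefTerm j t t'] [hr : DefTerm j r r'] [hq : DefTerm j q q']
    [hp : DefTerm j p p'] :
    DefPair j (fun e => IsInternalIso (s e) (t e) (r e) (q e) (p e))
      fun e => IsInternalIso (s' e) (t' e) (r' e) (q' e) (p' e) :=
  subst j (P := fun e => IsInternalIso (e 0) (e 1) (e 2) (e 3) (e 4))
    (Q := fun e => IsInternalIso (e 0) (e 1) (e 2) (e 3) (e 4))
    (by unfold IsInternalIso; infer_instance)
    (t := ![s, t, r, q, p]) (t' := ![s', t', r', q', p'])
    (by simpa [Fin.forall_fin_succ] using ⟨hs, ht, hr, hq, hp⟩)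

instance isGameSystem (l D F D' F' n S : (α → A) → A) (m E₁ G E₁' G' k R : (α → B) → B)
    [hl : DefTerm j l m] [hD : DefTerm j D E₁] [hF : DefTerm j F G] [hD' : DefTerm j D' E₁']
    [hF' : DefTerm j F' G'] [hn : DefTerm j n k] [hS : DefTerm j S R] :
    DefPair j (fun e => IsGameSystem (l e) (D e) (F e) (D' e) (F' e) (n e) (S e))
      fun e => IsGameSystem (m e) (E₁ e) (G e) (E₁' e) (G' e) (k e) (R e) :=
  subst j (P := fun e => IsGameSystem (e 0) (e 1) (e 2) (e 3) (e 4) (e 5) (e 6))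
    (Q := fun e => IsGameSystem (e 0) (e 1) (e 2) (e 3) (e 4) (e 5) (e 6))
    (by unfold IsGameSystem; infer_instance)
    (t := ![l, D, F, D', F', n, S]) (t' := ![m, E₁, G, E₁', G', k, R])
    (by simpa [Fin.forall_fin_succ] using ⟨hl, hD, hF, hD', hF', hn, hS⟩)

theorem hasGameSystems (l D F D' F' : A) :
    DefPair j (fun _ : α → A => HasGameSystems l D F D' F')
      fun _ => HasGameSystems (j l) (j D) (j F) (j D') (j F') := by
  unfold HasGameSystems
  infer_instance

end DefPair

end Definability

/-! ### Game systems in transitive models of `ZFC⁻` -/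

section Codes

variable {L : FirstOrder.Language.{a, b}} (c : SymbolCoding.{u} L) (D : ZFSet.{u}) [L.Structure D]

/-- The function which sends each symbol to its interpretation, as a set. -/
noncomputable def SymbolCoding.interpFun : ZFSet.{u} :=
  haveI := c.countable
  ZFSet.range fun s : L.Symbols => ZFSet.pair (c.code s) (interpCode D s)

variable {D}

theorem SymbolCoding.interpFun_mem {V : Set ZFSet.{u}} (hV : IsTransitiveClass V)
    (hM : c.structureCode D ∈ V) : c.interpFun D ∈ V := snd_mem_of_pair hV hM

theorem SymbolCoding.languageCode_mem {V : Set ZFSet.{u}} (hV : IsTransitiveClass V)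
    {T : L.Theory} (hT : c.theoryCode T ∈ V) : c.languageCode ∈ V := fst_mem_of_pair hV hT

theorem SymbolCoding.pair_mem_interpFun_iff {s R : ZFSet.{u}} :
    ZFSet.pair s R ∈ c.interpFun D ↔ ∃ σ, s = c.code σ ∧ R = interpCode D σ := by
  have := c.countable
  simp only [interpFun, ZFSet.mem_range, ZFSet.pair_inj, eq_comm]

theorem SymbolCoding.mem_languageCode_iff {t : ZFSet.{u}} :
    t ∈ c.languageCode ↔ ∃ σ, t = ZFSet.pair (c.code σ)
      (ZFSet.pair (numeral (Sum.elim (fun _ => 0) (fun _ => 1) σ))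
        (ZFSet.pair (numeral (Sum.elim Sigma.fst Sigma.fst σ))
          (ZFSet.pair (numeral (c.index σ)) ∅))) := by
  have := c.countable
  simp only [languageCode, ZFSet.mem_range]
  exact ⟨fun ⟨σ, h⟩ => ⟨σ, h.symm⟩, fun ⟨σ, h⟩ => ⟨σ, h.symm⟩⟩

theorem pair_tuple_mem_interpCode_iff {m n : ℕ} {f : L.Functions m} {s : Fin n → D} {d : D} :
    ZFSet.pair (tuple fun i => (s i : ZFSet.{u})) d ∈ SymbolCoding.interpCode D (.inl ⟨m, f⟩) ↔
      ∃ e : m = n, Structure.funMap f (s ∘ Fin.cast e) = d := by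
  simp only [SymbolCoding.interpCode, ZFSet.mem_range, ZFSet.pair_inj]
  constructor
  · rintro ⟨t, ht, hd⟩
    obtain ⟨rfl, ht⟩ := tuple_inj ht
    obtain rfl : t = s := funext fun i => Subtype.ext (congrFun ht i)
    exact ⟨rfl, Subtype.ext hd⟩
  · rintro ⟨rfl, h⟩
    exact ⟨s, rfl, congrArg Subtype.val h⟩

theorem tuple_mem_interpCode_iff {m n : ℕ} {R : L.Relations m} {s : Fin n → D} :
    (tuple fun i => (s i : ZFSet.{u})) ∈ SymbolCoding.interpCode D (.inr ⟨m, R⟩) ↔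
      ∃ e : m = n, Structure.RelMap R (s ∘ Fin.cast e) := by
  simp only [SymbolCoding.interpCode, ZFSet.mem_range]
  constructor
  · rintro ⟨⟨t, hR⟩, ht⟩
    obtain ⟨rfl, ht⟩ := tuple_inj ht
    obtain rfl : t = s := funext fun i => Subtype.ext (congrFun ht i)
    exact ⟨rfl, hR⟩
  · rintro ⟨rfl, h⟩
    exact ⟨⟨s, h⟩, rfl⟩

end Codes

section Systems

/-- The relation between the elements of `D` and of `D'` whose graph is the set `f`. -/
def relOf (D D' f : ZFSet.{u}) : Set (D × D') := {p | ZFSet.pair p.1 p.2 ∈ f}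

variable {L : FirstOrder.Language.{a, b}} (c : SymbolCoding.{u} L) {V : Set ZFSet.{u}}
  (hV : IsTransitiveClass V) (hZ : ModelsZFCMinus V)
  {D D' : ZFSet.{u}} [L.Structure D] [L.Structure D']

omit [L.Structure D] [L.Structure D'] in
include hV hZ in
/-- In a transitive model, the pairs in a tuple relation are pairs of true tuples. The induction
runs along the transitive closure of membership, since the tail of a tuple is a member of a member.
-/
theorem exists_tuple_of_isTupleRel {H f : V} (hf : f.1 ⊆ ZFSet.prod D D') (hH : IsTupleRel H f)
    {z z' : V} (hz : Related H z z') :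
    ∃ (m : ℕ) (s : Fin m → D) (t : Fin m → D'), (∀ i, (s i, t i) ∈ relOf D D' f) ∧
      z.1 = (tuple fun i => (s i).1) ∧ z'.1 = tuple fun i => (t i).1 := by
  suffices h : ∀ (x : ZFSet.{u}) (z z' : V), z.1 = x → Related H z z' →
      ∃ (m : ℕ) (s : Fin m → D) (t : Fin m → D'), (∀ i, (s i, t i) ∈ relOf D D' f) ∧
        z.1 = (tuple fun i => (s i).1) ∧ z'.1 = tuple fun i => (t i).1 from h _ z z' rfl hz
  intro x
  induction x using ZFSet.mem_wf.transGen.induction with | _ x ih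
  rintro z z' rfl hz
  obtain ⟨y, y', hp, h⟩ := hH ⟨_, hV _ H.2 _ ((related_iff hV hZ).1 hz)⟩ ((related_iff hV hZ).1 hz)
  obtain ⟨h₁, h₂⟩ := ZFSet.pair_inj.1 ((isPair_iff hV hZ).1 hp)
  obtain rfl : z = y := Subtype.ext h₁
  obtain rfl : z' = y' := Subtype.ext h₂
  rcases h with ⟨he, he'⟩ | ⟨d, d', q, q', hd, hq, hdz, hdz'⟩
  · exact ⟨0, Fin.elim0, Fin.elim0, fun i => i.elim0, (forall_not_mem_iff hV).1 he,
      (forall_not_mem_iff hV).1 he'⟩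
  · rw [isPair_iff hV hZ] at hdz hdz'
    obtain ⟨m, s, t, hst, hs, ht⟩ := ih q.1 (by
      rw [hdz]
      exact .tail (.single (show q.1 ∈ ({d.1, q.1} : ZFSet.{u}) by simp)) (by simp [ZFSet.pair]))
      q q' rfl hq
    have hd' := (related_iff hV hZ).1 hd
    obtain ⟨hdD, hdD'⟩ := ZFSet.pair_mem_prod.1 (hf hd')
    refine ⟨m + 1, Fin.cons ⟨d.1, hdD⟩ s, Fin.cons ⟨d'.1, hdD'⟩ t, fun i => ?_, ?_, ?_⟩
    · refine Fin.cases hd' (fun i => ?_) i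
      exact hst i
    · rw [hdz, hs]; rfl
    · rw [hdz', ht]; rfl

include hV hZ in
theorem isInternalIso_of_isPartialIso (hL : c.languageCode ∈ V) (hM : c.structureCode D ∈ V)
    (hM' : c.structureCode D' ∈ V) {f : V} (hf : f.1 ⊆ ZFSet.prod D D') {n : V} {N : ℕ}
    (hn : n.1 = numeral N) (h : IsPartialIso (fun s => c.index s < N) (relOf D D' f)) :
    IsInternalIso ⟨_, hL⟩ ⟨_, c.interpFun_mem hV hM⟩ ⟨_, c.interpFun_mem hV hM'⟩ n f := by
  refine ⟨?_, ?_⟩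
  · intro x y x' y' hxy hxy'
    rw [related_iff hV hZ] at hxy hxy'
    obtain ⟨hx, hy⟩ := ZFSet.pair_mem_prod.1 (hf hxy)
    obtain ⟨hx', hy'⟩ := ZFSet.pair_mem_prod.1 (hf hxy')
    have := h.eq_iff (⟨x.1, hx⟩, ⟨y.1, hy⟩) hxy (⟨x'.1, hx'⟩, ⟨y'.1, hy'⟩) hxy'
    simpa [Subtype.ext_iff] using this
  · intro H hH z z' hz s k R R' hs hR hR'
    obtain ⟨m, σ, τ, hστ, hzσ, hzτ⟩ := exists_tuple_of_isTupleRel hV hZ hf hH hz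
    obtain ⟨t₀, t₁, t₂, t₃, ar, i, ht₀, hi, h₀, h₁, h₂, t₄, h₃⟩ := hs
    rw [isPair_iff hV hZ] at h₀ h₁ h₂ h₃
    obtain ⟨sym, hsym⟩ := c.mem_languageCode_iff.1 ht₀
    simp only [Matrix.cons_val_zero] at hsym
    rw [h₀, h₁, h₂, h₃] at hsym
    simp only [ZFSet.pair_inj] at hsym
    obtain ⟨hs, hk, -, hi', -⟩ := hsym
    have hidx : c.index sym < N := by
      rw [← numeral_mem_numeral_iff, ← hi', ← hn]
      exact hi
    obtain ⟨sym₁, hs₁, hR⟩ := c.pair_mem_interpFun_iff.1 ((related_iff hV hZ).1 hR)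
    obtain ⟨sym₂, hs₂, hR'⟩ := c.pair_mem_interpFun_iff.1 ((related_iff hV hZ).1 hR')
    obtain rfl := c.code_injective (hs₁.symm.trans hs)
    obtain rfl := c.code_injective (hs₂.symm.trans hs)
    rcases sym₂ with ⟨l, g⟩ | ⟨l, g⟩
    · have hk0 : k.1 = ∅ := hk
      refine ⟨fun _ x y hxy => ?_, fun ⟨r, hr⟩ => absurd hr ((forall_not_mem_iff hV).2 hk0 r)⟩
      rw [related_iff hV hZ] at hxy ⊢
      rw [related_iff hV hZ]
      obtain ⟨hx, hy⟩ := ZFSet.pair_mem_prod.1 (hf hxy)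
      rw [hR, hR', hzσ, hzτ]
      refine (pair_tuple_mem_interpCode_iff (d := ⟨x.1, hx⟩)).trans (Iff.trans ?_
        (pair_tuple_mem_interpCode_iff (d := ⟨y.1, hy⟩)).symm)
      refine exists_congr fun e => ?_
      subst e
      exact h.funMap_iff g hidx _ _ hστ (⟨x.1, hx⟩, ⟨y.1, hy⟩) hxy
    · have hk1 : k.1 = insert ∅ ∅ := hk
      refine ⟨fun hk => ?_, fun _ => ?_⟩
      · rw [forall_not_mem_iff hV, hk1] at hk
        have hmem := ZFSet.mem_insert (∅ : ZFSet.{u}) ∅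
        rw [hk] at hmem
        exact absurd hmem (ZFSet.notMem_empty ∅)
      · rw [E_iff, E_iff, hR, hR', hzσ, hzτ, tuple_mem_interpCode_iff, tuple_mem_interpCode_iff]
        refine exists_congr fun e => ?_
        subst e
        exact h.relMap_iff g hidx _ _ hστ

omit [L.Structure D] [L.Structure D'] in
theorem relOf_insert {x : D} {y : D'} {f : ZFSet.{u}} :
    relOf D D' (insert (ZFSet.pair x y) f) = insert (x, y) (relOf D D' f) := by
  ext ⟨x', y'⟩
  change ZFSet.pair x'.1 y'.1 ∈ insert (ZFSet.pair x.1 y.1) f ↔ _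
  rw [ZFSet.mem_insert_iff, ZFSet.pair_inj, Set.mem_insert_iff, Prod.mk.injEq, Subtype.ext_iff,
    Subtype.ext_iff]
  rfl

include hV hZ in
/-- A position of the Ehrenfeucht–Fraïssé game which the second player wins belongs to a game
system: collection provides a set of game systems which contain positions that answer each possible
next move, and the union of these systems, together with the given position, is a game system. -/
theorem exists_isGameSystem (hL : c.languageCode ∈ V) (hM : c.structureCode D ∈ V)
    (hM' : c.structureCode D' ∈ V) {n : V} {N : ℕ} (hn : n.1 = numeral N) (k : ℕ) (i : V)
    (hi : i.1 = numeral k) (f : V) (hf : f.1 ⊆ ZFSet.prod D D')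
    (h : IsEFEquiv c.index N k (relOf D D' f)) :
    ∃ S : V, IsGameSystem ⟨_, hL⟩ ⟨_, c.domain_mem hV hM⟩ ⟨_, c.interpFun_mem hV hM⟩
      ⟨_, c.domain_mem hV hM'⟩ ⟨_, c.interpFun_mem hV hM'⟩ n S ∧ Related S i f := by
  induction k generalizing i f with
  | zero =>
    refine ⟨⟨{ZFSet.pair i.1 f.1}, singleton_mem hV hZ (pair_mem hV hZ i.2 f.2)⟩, ?_,
      (related_iff hV hZ).2 (by simp)⟩
    intro p hp
    refine ⟨i, f, isPair_pair hV (ZFSet.mem_singleton.1 hp),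
      isInternalIso_of_isPartialIso c hV hZ hL hM hM' hf hn h, fun i' hi' => ?_⟩
    have h₁ := (isSucc_iff hV hZ).1 hi'
    rw [hi] at h₁
    exact absurd (h₁ ▸ ZFSet.mem_insert _ _ : i'.1 ∈ numeral 0) (ZFSet.notMem_empty _)
  | succ k ih =>
    -- the codes are made opaque, so that they are recognized as parameters of the definitions
    generalize hl : (⟨_, hL⟩ : V) = l at *
    generalize hdD : (⟨_, c.domain_mem hV hM⟩ : V) = dD at *
    generalize hdF : (⟨_, c.interpFun_mem hV hM⟩ : V) = dF at *
    generalize hdD' : (⟨_, c.domain_mem hV hM'⟩ : V) = dD' at *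
    generalize hdF' : (⟨_, c.interpFun_mem hV hM'⟩ : V) = dF' at *
    obtain ⟨i₀, hi₀⟩ : ∃ i₀ : V, i₀.1 = numeral k := ⟨⟨_, numeral_mem hV hZ k⟩, rfl⟩
    have hstep : ∀ (x y : V) (hx : x.1 ∈ D) (hy : y.1 ∈ D'),
        IsEFEquiv c.index N k (insert ((⟨x.1, hx⟩, ⟨y.1, hy⟩) : D × D') (relOf D D' f)) →
        ∃ S g, IsGameSystem l dD dF dD' dF' n S ∧ (∀ q, E q f → E q g) ∧ Related g x y ∧
          Related S i₀ g := by
      intro x y hx hy hxy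
      obtain ⟨S, hS, hSg⟩ := ih i₀ hi₀
        ⟨insert (ZFSet.pair x.1 y.1) f.1, insert_mem hV hZ (pair_mem hV hZ x.2 y.2) f.2⟩ (by
          intro q hq
          rcases ZFSet.mem_insert_iff.1 hq with rfl | hq
          exacts [ZFSet.pair_mem_prod.2 ⟨hx, hy⟩, hf hq])
        (by
          have := relOf_insert (x := (⟨x.1, hx⟩ : D)) (y := (⟨y.1, hy⟩ : D')) (f := f.1)
          rwa [← this] at hxy)
      exact ⟨S, _, hS, fun q hq => ZFSet.mem_insert_of_mem _ hq,
        (related_iff hV hZ).2 (ZFSet.mem_insert _ _), hSg⟩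
    obtain ⟨t₁, ht₁⟩ := hZ.exists_collection (fun x S => IsGameSystem l dD dF dD' dF' n S ∧
        ∃ y g, E y dD' ∧ (∀ q, E q f → E q g) ∧ Related g x y ∧ Related S i₀ g) dD (by
      intro x hx
      subst hdD hdD'
      obtain ⟨y, hy⟩ := h.2.1 ⟨x.1, hx⟩
      let y' : V := ⟨y.1, hV _ (c.domain_mem hV hM') _ y.2⟩
      obtain ⟨S, g, hS, hg⟩ := hstep x y' hx y.2 hy
      exact ⟨S, hS, y', g, y.2, hg⟩)
    obtain ⟨t₂, ht₂⟩ := hZ.exists_collection (fun y S => IsGameSystem l dD dF dD' dF' n S ∧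
        ∃ x g, E x dD ∧ (∀ q, E q f → E q g) ∧ Related g x y ∧ Related S i₀ g) dD' (by
      intro y hy
      subst hdD hdD'
      obtain ⟨x, hx⟩ := h.2.2 ⟨y.1, hy⟩
      let x' : V := ⟨x.1, hV _ (c.domain_mem hV hM) _ x.2⟩
      obtain ⟨S, g, hS, hg⟩ := hstep x' y x.2 hy hx
      exact ⟨S, hS, x', g, x.2, hg⟩)
    -- the sets given by collection may have further elements, which separation removes
    obtain ⟨t, ht⟩ := hZ.exists_sep (fun S => IsGameSystem l dD dF dD' dF' n S)
      ⟨_, union_mem hV hZ t₁.2 t₂.2⟩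
    obtain ⟨S, hS⟩ : ∃ S : V, S.1 = insert (ZFSet.pair i.1 f.1) (ZFSet.sUnion t.1) :=
      ⟨⟨_, insert_mem hV hZ (pair_mem hV hZ i.2 f.2) (sUnion_mem hV hZ t.2)⟩, rfl⟩
    have hsub : ∀ S', E S' t → ∀ i' g, Related S' i' g → Related S i' g := by
      intro S' hS' i' g hg
      rw [related_iff hV hZ] at hg ⊢
      rw [hS]
      exact ZFSet.mem_insert_of_mem _ (ZFSet.mem_sUnion.2 ⟨S'.1, hS', hg⟩)
    have hiso := isInternalIso_of_isPartialIso c hV hZ hL hM hM' hf hn h.isPartialIso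
    rw [hl, hdF, hdF'] at hiso
    refine ⟨S, fun p hp => ?_, (related_iff hV hZ).2 (hS ▸ ZFSet.mem_insert _ _)⟩
    have hp' : p.1 ∈ insert (ZFSet.pair i.1 f.1) (ZFSet.sUnion t.1) := hS ▸ hp
    rcases ZFSet.mem_insert_iff.1 hp' with hp' | hp'
    · refine ⟨i, f, isPair_pair hV hp', hiso, fun i' hi' => ?_⟩
      have h₁ := (isSucc_iff hV hZ).1 hi'
      rw [hi] at h₁
      obtain rfl : i₀ = i' := Subtype.ext (hi₀.trans (succ_injective h₁))
      constructor
      · intro x hx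
        obtain ⟨S', hS', hsys, y, g, hy, hfg, hxy, hg⟩ := ht₁ x hx
        exact ⟨y, g, hy, hfg, hxy, hsub S' ((ht S').2 ⟨ZFSet.mem_union.2 (.inl hS'), hsys⟩) _ _ hg⟩
      · intro y hy
        obtain ⟨S', hS', hsys, x, g, hx, hfg, hxy, hg⟩ := ht₂ y hy
        exact ⟨x, g, hx, hfg, hxy, hsub S' ((ht S').2 ⟨ZFSet.mem_union.2 (.inr hS'), hsys⟩) _ _ hg⟩
    · obtain ⟨s, hs, hps⟩ := ZFSet.mem_sUnion.1 hp'
      have hs' : E (⟨s, hV _ t.2 _ hs⟩ : V) t := hs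
      obtain ⟨i₁, f₁, hif, hiso₁, hext⟩ := ((ht _).1 hs').2 p hps
      refine ⟨i₁, f₁, hif, hiso₁, fun i' hi' => ⟨fun x hx => ?_, fun y hy => ?_⟩⟩
      · obtain ⟨y, g, hy, hfg, hxy, hg⟩ := (hext i' hi').1 x hx
        exact ⟨y, g, hy, hfg, hxy, hsub _ hs' _ _ hg⟩
      · obtain ⟨x, g, hx, hfg, hxy, hg⟩ := (hext i' hi').2 y hy
        exact ⟨x, g, hx, hfg, hxy, hsub _ hs' _ _ hg⟩

include hV hZ in
/-- In a transitive model, a natural number `n` is standard and a finite set `X` is truly finite, so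
the Ehrenfeucht–Fraïssé game on the true structures gives a position with `n` remaining moves. -/
theorem hasGameSystems_of_elementarilyEquivalent (hL : c.languageCode ∈ V)
    (hM : c.structureCode D ∈ V) (hM' : c.structureCode D' ∈ V) (h : D ≅[L] D') :
    HasGameSystems (⟨_, hL⟩ : V) ⟨_, c.domain_mem hV hM⟩ ⟨_, c.interpFun_mem hV hM⟩
      ⟨_, c.domain_mem hV hM'⟩ ⟨_, c.interpFun_mem hV hM'⟩ := by
  intro n X hn hX
  obtain ⟨N, hN⟩ := (isNatural_iff hV hZ).1 hn
  rw [isInternallyFinite_iff hV hZ] at hX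
  obtain ⟨g, hgfin, hg, hgX⟩ := IsEFEquiv.exists_of_elementarilyEquivalent c.index_injective h N N
    (X := {x : D | x.1 ∈ X.1}) (hX.preimage Subtype.val_injective.injOn)
  obtain ⟨f, hfV, hf⟩ := exists_mem_iff_of_finite hV hZ
    (hgfin.image fun p : D × D' => ZFSet.pair p.1 p.2) (by
      rintro _ ⟨p, -, rfl⟩
      exact pair_mem hV hZ (hV _ (c.domain_mem hV hM) _ p.1.2)
        (hV _ (c.domain_mem hV hM') _ p.2.2))
  have hfg : ∀ {x y : ZFSet.{u}}, ZFSet.pair x y ∈ f ↔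
      ∃ (hx : x ∈ D) (hy : y ∈ D'), ((⟨x, hx⟩, ⟨y, hy⟩) : D × D') ∈ g := by
    intro x y
    rw [hf]
    constructor
    · rintro ⟨⟨x', y'⟩, hp, hxy⟩
      obtain ⟨rfl, rfl⟩ := ZFSet.pair_inj.1 hxy
      exact ⟨x'.2, y'.2, hp⟩
    · rintro ⟨hx, hy, hp⟩
      exact ⟨_, hp, rfl⟩
  obtain ⟨Y, hYV, hY⟩ := exists_mem_iff_of_finite hV hZ
    (hgfin.image fun p : D × D' => p.2.1) (by
      rintro _ ⟨p, -, rfl⟩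
      exact hV _ (c.domain_mem hV hM') _ p.2.2)
  have hrel : relOf D D' f = g := by
    ext ⟨x, y⟩
    exact hfg.trans ⟨fun ⟨_, _, h⟩ => h, fun h => ⟨x.2, y.2, h⟩⟩
  obtain ⟨S, hS, hSf⟩ := exists_isGameSystem c hV hZ hL hM hM' hN N n hN ⟨f, hfV⟩ (by
    intro q hq
    obtain ⟨p, -, rfl⟩ := (hf q).1 hq
    exact ZFSet.pair_mem_prod.2 ⟨p.1.2, p.2.2⟩) (hrel ▸ hg)
  refine ⟨S, ⟨f, hfV⟩, ⟨Y, hYV⟩, hS, hSf, (isInternallyFinite_iff hV hZ).2 ?_, ?_, ?_⟩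
  · exact (hgfin.image fun p : D × D' => p.2.1).subset fun r hr => (hY r).1 hr
  · intro x hxX hxD
    obtain ⟨y, hy⟩ := hgX ⟨x.1, hxD⟩ hxX
    exact ⟨⟨y.1, hV _ (c.domain_mem hV hM') _ y.2⟩, y.2,
      (related_iff hV hZ).2 (hfg.2 ⟨hxD, y.2, hy⟩)⟩
  · intro x y hxy
    obtain ⟨hx, hy, hp⟩ := hfg.1 ((related_iff hV hZ).1 hxy)
    exact (hY _).2 ⟨_, hp, rfl⟩

end Systems

/-! ### Elementary extensions of transitive models -/

section Target

variable {V : Set ZFSet.{u}} (hV : IsTransitiveClass V) (hZ : ModelsZFCMinus V)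
  {W : Type w} [setLang.Structure W] (j : V ↪ₑ[setLang] W)

include hV j

theorem target_ext {s t : W} (h : ∀ r, E r s ↔ E r t) : s = t :=
  (transfer j (P := ∀ s t : V, (∀ r, E r s ↔ E r t) → s = t)
    (Q := ∀ s t : W, (∀ r, E r s ↔ E r t) → s = t)).1 (fun _ _ => ext_of_transitive hV) s t h

theorem target_isPair_unique {s t p p' : W} (h : IsPair s t p) (h' : IsPair s t p') : p = p' :=
  target_ext hV j fun z => (h z).trans (h' z).symm

theorem target_isTuple_unique {n : ℕ} {f : Fin n → W} {z z' : W} (h : IsTuple f z)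
    (h' : IsTuple f z') : z = z' := by
  induction n generalizing z z' with
  | zero => exact target_ext hV j fun r => iff_of_false (h r) (h' r)
  | succ n ih =>
    obtain ⟨t, ht, hz⟩ := h
    obtain ⟨t', ht', hz'⟩ := h'
    obtain rfl := ih ht ht'
    exact target_isPair_unique hV j hz hz'

include hZ

theorem target_exists_isPair (s t : W) : ∃ p, IsPair s t p :=
  (transfer j (P := ∀ s t : V, ∃ p, IsPair s t p) (Q := ∀ s t : W, ∃ p, IsPair s t p)).1
    (fun s t => ⟨⟨_, pair_mem hV hZ s.2 t.2⟩, isPair_pair hV rfl⟩) s t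

theorem target_isPair_inj {s t s' t' p : W} (h : IsPair s t p) (h' : IsPair s' t' p) :
    s = s' ∧ t = t' :=
  (transfer j (P := ∀ s t s' t' p : V, IsPair s t p → IsPair s' t' p → s = s' ∧ t = t')
    (Q := ∀ s t s' t' p : W, IsPair s t p → IsPair s' t' p → s = s' ∧ t = t')).1
    (fun s t s' t' p h h' => by
      rw [isPair_iff hV hZ] at h h'
      obtain ⟨h₁, h₂⟩ := ZFSet.pair_inj.1 (h.symm.trans h')
      exact ⟨Subtype.ext h₁, Subtype.ext h₂⟩) s t s' t' p h h'

theorem target_exists_empty : ∃ e : W, ∀ r, ¬ E r e :=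
  (transfer j (P := ∃ e : V, ∀ r, ¬ E r e) (Q := ∃ e : W, ∀ r, ¬ E r e)).1
    ⟨⟨∅, empty_mem hV hZ⟩, (forall_not_mem_iff hV).2 rfl⟩

theorem target_exists_adjoin (s t : W) : ∃ q, ∀ r, E r q ↔ E r s ∨ r = t :=
  (transfer j (P := ∀ s t : V, ∃ q, ∀ r, E r q ↔ E r s ∨ r = t)
    (Q := ∀ s t : W, ∃ q, ∀ r, E r q ↔ E r s ∨ r = t)).1
    (fun s t => ⟨⟨_, insert_mem hV hZ t.2 s.2⟩, fun r => by
      rw [E_iff, ZFSet.mem_insert_iff, or_comm, E_iff, Subtype.ext_iff]⟩) s t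

theorem target_exists_isTuple {n : ℕ} (f : Fin n → W) : ∃ z, IsTuple f z := by
  induction n with
  | zero => exact target_exists_empty hV hZ j
  | succ n ih =>
    obtain ⟨t, ht⟩ := ih (Fin.tail f)
    obtain ⟨z, hz⟩ := target_exists_isPair hV hZ j (f 0) t
    exact ⟨z, t, ht, hz⟩

/-- Tuples of standard length with related entries are related by some tuple relation, namely the
one which consists of their tails. -/
theorem target_exists_isTupleRel {n : ℕ} {s t : Fin n → W} {f z z' : W}
    (h : ∀ i, Related f (s i) (t i)) (hz : IsTuple s z) (hz' : IsTuple t z') :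
    ∃ H, IsTupleRel H f ∧ Related H z z' := by
  have key : ∀ {z z' H₀ : W}, IsTupleRel H₀ f → ((∀ r, ¬ E r z) ∧ (∀ r, ¬ E r z') ∨
      ∃ c d q q', Related f c d ∧ Related H₀ q q' ∧ IsPair c q z ∧ IsPair d q' z') →
      ∃ H, IsTupleRel H f ∧ Related H z z' := by
    intro z z' H₀ hH₀ hzz
    obtain ⟨p, hp⟩ := target_exists_isPair hV hZ j z z'
    obtain ⟨H, hH⟩ := target_exists_adjoin hV hZ j H₀ p
    have hsub : ∀ q q', Related H₀ q q' → Related H q q' := fun q q' ⟨r, hr, hr'⟩ =>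
      ⟨r, hr, (hH r).2 (.inl hr')⟩
    refine ⟨H, fun r hr => ?_, p, hp, (hH p).2 (.inr rfl)⟩
    rcases (hH r).1 hr with hr | rfl
    · obtain ⟨y, y', hy, h⟩ := hH₀ r hr
      refine ⟨y, y', hy, h.imp_right ?_⟩
      rintro ⟨c, d, q, q', hcd, hq, h⟩
      exact ⟨c, d, q, q', hcd, hsub _ _ hq, h⟩
    · refine ⟨z, z', hp, hzz.imp_right ?_⟩
      rintro ⟨c, d, q, q', hcd, hq, h⟩
      exact ⟨c, d, q, q', hcd, hsub _ _ hq, h⟩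
  induction n generalizing z z' with
  | zero =>
    obtain ⟨e, he⟩ := target_exists_empty hV hZ j
    exact key (fun p hp => absurd hp (he p)) (.inl ⟨hz, hz'⟩)
  | succ n ih =>
    obtain ⟨q, hq, hz⟩ := hz
    obtain ⟨q', hq', hz'⟩ := hz'
    obtain ⟨H₀, hH₀, hqq⟩ := ih (s := Fin.tail s) (t := Fin.tail t) (fun i => h i.succ) hq hq'
    exact key hH₀ (.inr ⟨s 0, t 0, q, q', h 0, hqq, hz, hz'⟩)

theorem target_natural_cases {n : W} (hn : IsNatural n) :
    (∀ r, ¬ E r n) ∨ ∃ m, IsNatural m ∧ ∀ r, E r n ↔ E r m ∨ r = m :=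
  (transfer j (P := ∀ n : V, IsNatural n →
      (∀ r, ¬ E r n) ∨ ∃ m, IsNatural m ∧ ∀ r, E r n ↔ E r m ∨ r = m)
    (Q := ∀ n : W, IsNatural n →
      (∀ r, ¬ E r n) ∨ ∃ m, IsNatural m ∧ ∀ r, E r n ↔ E r m ∨ r = m)).1
    (fun n hn => by
      obtain ⟨k, hk⟩ := (isNatural_iff hV hZ).1 hn
      cases k with
      | zero => exact .inl ((forall_not_mem_iff hV).2 hk)
      | succ k =>
        exact .inr ⟨⟨_, numeral_mem hV hZ k⟩, (isNatural_iff hV hZ).2 ⟨k, rfl⟩,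
          (isSucc_iff hV hZ).2 hk⟩) n hn

theorem target_natural_trichotomy {m n : W} (hm : IsNatural m) (hn : IsNatural n) :
    E m n ∨ m = n ∨ E n m :=
  (transfer j (P := ∀ m n : V, IsNatural m → IsNatural n → E m n ∨ m = n ∨ E n m)
    (Q := ∀ m n : W, IsNatural m → IsNatural n → E m n ∨ m = n ∨ E n m)).1
    (fun m n hm hn => by
      obtain ⟨k, hk⟩ := (isNatural_iff hV hZ).1 hm
      obtain ⟨l, hl⟩ := (isNatural_iff hV hZ).1 hn
      rw [E_iff, E_iff, Subtype.ext_iff, hk, hl, numeral_mem_numeral_iff, numeral_mem_numeral_iff,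
        numeral_injective.eq_iff]
      exact lt_trichotomy k l) m n hm hn

theorem target_mem_numeral_iff {k : ℕ} {r : W} :
    E r (j ⟨_, numeral_mem hV hZ k⟩) ↔ ∃ l < k, r = j ⟨_, numeral_mem hV hZ l⟩ := by
  induction k with
  | zero =>
    have := (transfer j (P := ∀ r : V, ¬ E r ⟨_, numeral_mem hV hZ 0⟩)
      (Q := ∀ r : W, ¬ E r (j ⟨_, numeral_mem hV hZ 0⟩))).1 ((forall_not_mem_iff hV).2 rfl)
    simpa using this r
  | succ k ih =>
    have := (transfer j (P := ∀ r : V, E r ⟨_, numeral_mem hV hZ (k + 1)⟩ ↔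
        E r ⟨_, numeral_mem hV hZ k⟩ ∨ r = ⟨_, numeral_mem hV hZ k⟩)
      (Q := ∀ r : W, E r (j ⟨_, numeral_mem hV hZ (k + 1)⟩) ↔
        E r (j ⟨_, numeral_mem hV hZ k⟩) ∨ r = j ⟨_, numeral_mem hV hZ k⟩)).1
      ((isSucc_iff hV hZ).2 rfl) r
    rw [this, ih]
    constructor
    · rintro (⟨l, hl, rfl⟩ | rfl)
      exacts [⟨l, by omega, rfl⟩, ⟨k, by omega, rfl⟩]
    · rintro ⟨l, hl, rfl⟩
      rcases Nat.lt_succ_iff_lt_or_eq.1 hl with h | rfl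
      exacts [Or.inl ⟨l, h, rfl⟩, Or.inr rfl]

/-- The standard natural numbers of an elementary extension lie below the nonstandard ones. -/
theorem target_numeral_mem_of_infinite {n : W} (hn : IsNatural n) (hinf : {r | E r n}.Infinite)
    (k : ℕ) : E (j ⟨_, numeral_mem hV hZ k⟩) n := by
  have hfin : ∀ l : ℕ, {r | E r (j ⟨_, numeral_mem hV hZ l⟩)}.Finite := by
    intro l
    refine (Set.finite_range fun i : Fin l => j ⟨_, numeral_mem hV hZ i⟩).subset fun r hr => ?_
    obtain ⟨l', hl', rfl⟩ := (target_mem_numeral_iff hV hZ j).1 hr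
    exact ⟨⟨l', hl'⟩, rfl⟩
  have hk : IsNatural (j ⟨_, numeral_mem hV hZ k⟩) :=
    (transfer j (P := IsNatural (⟨_, numeral_mem hV hZ k⟩ : V))).1
      ((isNatural_iff hV hZ).2 ⟨k, rfl⟩)
  rcases target_natural_trichotomy hV hZ j hk hn with h | h | h
  · exact h
  · exact absurd (h ▸ hfin k) hinf
  · obtain ⟨l, -, rfl⟩ := (target_mem_numeral_iff hV hZ j).1 h
    exact absurd (hfin l) hinf

end Target

section JStd

variable {L : FirstOrder.Language.{a, b}} (c : SymbolCoding.{u} L) {V : Set ZFSet.{u}}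
  (hV : IsTransitiveClass V) (hZ : ModelsZFCMinus V) {W : Type w} [setLang.Structure W]
  (j : V ↪ₑ[setLang] W) {D D' : ZFSet.{u}} [L.Structure D] [L.Structure D']
  (hL : c.languageCode ∈ V) (hM : c.structureCode D ∈ V) (hM' : c.structureCode D' ∈ V)

include hZ in
theorem jInterp_functional {m : ℕ} (g : L.Functions m) {z d d' : W}
    (h : Related (jInterp c hV j hM (.inl ⟨m, g⟩)) z d)
    (h' : Related (jInterp c hV j hM (.inl ⟨m, g⟩)) z d') : d = d' :=
  (transfer j
    (P := ∀ z d d' : V,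
      Related ⟨SymbolCoding.interpCode D (.inl ⟨m, g⟩), c.interpCode_mem hV hM _⟩ z d →
      Related ⟨SymbolCoding.interpCode D (.inl ⟨m, g⟩), c.interpCode_mem hV hM _⟩ z d' → d = d')
    (Q := ∀ z d d' : W, Related (jInterp c hV j hM (.inl ⟨m, g⟩)) z d →
      Related (jInterp c hV j hM (.inl ⟨m, g⟩)) z d' → d = d')
    (h := by unfold jInterp; infer_instance)).1
    (fun z d d' h h' => by
      rw [related_iff hV hZ] at h h'
      simp only [SymbolCoding.interpCode, ZFSet.mem_range, ZFSet.pair_inj] at h h'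
      obtain ⟨t, ht, hd⟩ := h
      obtain ⟨t', ht', hd'⟩ := h'
      obtain ⟨_, htt⟩ := tuple_inj (ht.trans ht'.symm)
      obtain rfl : t = t' := funext fun i => Subtype.ext (congrFun htt i)
      exact Subtype.ext (hd.symm.trans hd')) z d d' h h'

include hZ in
theorem jStd_funMap_eq_iff {m : ℕ} (g : L.Functions m) {s : Fin m → JStd c hV j hM} {z : W}
    (hz : IsTuple (fun i => (s i).1) z) (d : JStd c hV j hM) :
    Structure.funMap g s = d ↔ Related (jInterp c hV j hM (.inl ⟨m, g⟩)) z d.1 := by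
  obtain ⟨z', p, hz', hp, hpG⟩ : JStdGraph c hV j hM g s (Structure.funMap g s) :=
    (exists_jStdGraph c hV j hM g s).choose_spec
  obtain rfl := target_isTuple_unique hV j hz hz'
  constructor
  · rintro rfl
    exact ⟨p, hp, hpG⟩
  · intro h
    exact Subtype.ext (jInterp_functional c hV hZ j hM g ⟨p, hp, hpG⟩ h)

include hV in
theorem code_mem (hL : c.languageCode ∈ V) (σ : L.Symbols) : c.code σ ∈ V :=
  SymbolCoding.fst_mem_of_pair hV (hV _ hL _ (c.mem_languageCode_iff.2 ⟨σ, rfl⟩))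

include hZ in
/-- Each symbol of the standard language is a symbol with index in `n`, for each nonstandard `n`. -/
theorem target_isSymbol {n : W} (hn : IsNatural n) (hinf : {r | E r n}.Infinite) (σ : L.Symbols) :
    IsSymbol (j ⟨_, hL⟩) n (j ⟨_, code_mem c hV hL σ⟩)
      (j ⟨_, numeral_mem hV hZ (Sum.elim (fun _ => 0) (fun _ => 1) σ)⟩) := by
  have h₀ : ∃ t₀ t₁ t₂ t₃ m : V, E t₀ ⟨_, hL⟩ ∧ IsPair ⟨_, code_mem c hV hL σ⟩ t₁ t₀ ∧
      IsPair ⟨_, numeral_mem hV hZ (Sum.elim (fun _ => 0) (fun _ => 1) σ)⟩ t₂ t₁ ∧ IsPair m t₃ t₂ ∧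
      ∃ t₄, IsPair ⟨_, numeral_mem hV hZ (c.index σ)⟩ t₄ t₃ := by
    have h₃ := pair_mem hV hZ (numeral_mem hV hZ (c.index σ)) (empty_mem hV hZ)
    have h₂ := pair_mem hV hZ (numeral_mem hV hZ (Sum.elim Sigma.fst Sigma.fst σ)) h₃
    have h₁ := pair_mem hV hZ (numeral_mem hV hZ (Sum.elim (fun _ => 0) (fun _ => 1) σ)) h₂
    exact ⟨⟨_, pair_mem hV hZ (code_mem c hV hL σ) h₁⟩, ⟨_, h₁⟩, ⟨_, h₂⟩, ⟨_, h₃⟩,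
      ⟨_, numeral_mem hV hZ _⟩, c.mem_languageCode_iff.2 ⟨σ, rfl⟩, isPair_pair hV rfl,
      isPair_pair hV rfl, isPair_pair hV rfl, ⟨_, empty_mem hV hZ⟩, isPair_pair hV rfl⟩
  obtain ⟨t₀, t₁, t₂, t₃, m, h₁, h₂, h₃, h₄, h₅⟩ := (transfer j
    (Q := ∃ t₀ t₁ t₂ t₃ m : W, E t₀ (j ⟨_, hL⟩) ∧ IsPair (j ⟨_, code_mem c hV hL σ⟩) t₁ t₀ ∧
      IsPair (j ⟨_, numeral_mem hV hZ (Sum.elim (fun _ => 0) (fun _ => 1) σ)⟩) t₂ t₁ ∧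
      IsPair m t₃ t₂ ∧ ∃ t₄, IsPair (j ⟨_, numeral_mem hV hZ (c.index σ)⟩) t₄ t₃)).1 h₀
  exact ⟨t₀, t₁, t₂, t₃, m, _, h₁, target_numeral_mem_of_infinite hV hZ j hn hinf _, h₂, h₃, h₄, h₅⟩

include hZ in
theorem target_related_interpFun (hL : c.languageCode ∈ V) (σ : L.Symbols) :
    Related (j ⟨_, c.interpFun_mem hV hM⟩) (j ⟨_, code_mem c hV hL σ⟩) (jInterp c hV j hM σ) :=
  (transfer j (P := Related (⟨_, c.interpFun_mem hV hM⟩ : V) ⟨_, code_mem c hV hL σ⟩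
      ⟨_, c.interpCode_mem hV hM σ⟩) (h := by unfold jInterp; infer_instance)).1
    ((related_iff hV hZ).2 (c.pair_mem_interpFun_iff.2 ⟨σ, rfl, rfl⟩))

/-- The relation between `j_std(M)` and `j_std(M')` given by a set of pairs. -/
def jRel (f : W) : Set (JStd c hV j hM × JStd c hV j hM') := {p | Related f p.1.1 p.2.1}

include hZ in
/-- If `n` is nonstandard, an internal partial isomorphism for the symbols with index in `n`
respects all the standard symbols. -/
theorem isPartialIso_jRel {n f : W} (hn : IsNatural n) (hinf : {r | E r n}.Infinite)
    (h : IsInternalIso (j ⟨_, hL⟩) (j ⟨_, c.interpFun_mem hV hM⟩)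
      (j ⟨_, c.interpFun_mem hV hM'⟩) n f) :
    IsPartialIso (L := L) (fun _ => True) (jRel c hV j hM hM' f) where
  eq_iff p hp q hq := by
    have := h.1 _ _ _ _ hp hq
    exact ⟨fun e => Subtype.ext (this.1 (congrArg Subtype.val e)),
      fun e => Subtype.ext (this.2 (congrArg Subtype.val e))⟩
  funMap_iff {m} g _ s t hst p hp := by
    obtain ⟨z, hz⟩ := target_exists_isTuple hV hZ j fun i => (s i).1
    obtain ⟨z', hz'⟩ := target_exists_isTuple hV hZ j fun i => (t i).1
    obtain ⟨H, hH, hzz⟩ := target_exists_isTupleRel hV hZ j hst hz hz'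
    rw [jStd_funMap_eq_iff c hV hZ j hM g hz, jStd_funMap_eq_iff c hV hZ j hM' g hz']
    refine (h.2 H hH z z' hzz _ _ _ _ (target_isSymbol c hV hZ j hL hn hinf (.inl ⟨m, g⟩))
      (target_related_interpFun c hV hZ j hM hL _) (target_related_interpFun c hV hZ j hM' hL _)).1
      ?_ _ _ hp
    exact (transfer j (P := ∀ r : V, ¬ E r ⟨_, numeral_mem hV hZ 0⟩)
      (Q := ∀ r : W, ¬ E r (j ⟨_, numeral_mem hV hZ 0⟩))).1 ((forall_not_mem_iff hV).2 rfl)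
  relMap_iff {m} R _ s t hst := by
    obtain ⟨z, hz⟩ := target_exists_isTuple hV hZ j fun i => (s i).1
    obtain ⟨z', hz'⟩ := target_exists_isTuple hV hZ j fun i => (t i).1
    obtain ⟨H, hH, hzz⟩ := target_exists_isTupleRel hV hZ j hst hz hz'
    have key := (h.2 H hH z z' hzz _ _ _ _ (target_isSymbol c hV hZ j hL hn hinf (.inr ⟨m, R⟩))
      (target_related_interpFun c hV hZ j hM hL _) (target_related_interpFun c hV hZ j hM' hL _)).2
      ((transfer j (P := ∃ r : V, E r ⟨_, numeral_mem hV hZ 1⟩)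
        (Q := ∃ r : W, E r (j ⟨_, numeral_mem hV hZ 1⟩))).1
        ⟨⟨_, numeral_mem hV hZ 0⟩, numeral_mem_numeral_iff.2 zero_lt_one⟩)
    constructor
    · rintro ⟨y, hy, hyR⟩
      obtain rfl := target_isTuple_unique hV j hz hy
      exact ⟨z', hz', key.1 hyR⟩
    · rintro ⟨y, hy, hyR⟩
      obtain rfl := target_isTuple_unique hV j hz' hy
      exact ⟨z, hz, key.2 hyR⟩

/-- The relations given by the positions of a game system for which the number of remaining moves is
nonstandard. -/
def jSystem (S : W) : Set (Set (JStd c hV j hM × JStd c hV j hM')) :=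
  {g | ∃ i f, IsNatural i ∧ {r | E r i}.Infinite ∧ Related S i f ∧ g = jRel c hV j hM hM' f}

include hZ in
/-- A nonstandard natural number has a nonstandard predecessor, so that the game never stops. -/
theorem isBackAndForth_jSystem {n S : W} (hn : IsNatural n) (hinf : {r | E r n}.Infinite)
    (hS : IsGameSystem (j ⟨_, hL⟩) (j ⟨_, c.domain_mem hV hM⟩) (j ⟨_, c.interpFun_mem hV hM⟩)
      (j ⟨_, c.domain_mem hV hM'⟩) (j ⟨_, c.interpFun_mem hV hM'⟩) n S) :
    IsBackAndForth L (jSystem c hV j hM hM' S) := by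
  have key : ∀ i f, IsNatural i → {r | E r i}.Infinite → Related S i f →
      IsInternalIso (j ⟨_, hL⟩) (j ⟨_, c.interpFun_mem hV hM⟩) (j ⟨_, c.interpFun_mem hV hM'⟩) n f ∧
      ∃ i', IsNatural i' ∧ {r | E r i'}.Infinite ∧
        (∀ c₁, E c₁ (j ⟨_, c.domain_mem hV hM⟩) → ∃ d g, E d (j ⟨_, c.domain_mem hV hM'⟩) ∧
          (∀ q, E q f → E q g) ∧ Related g c₁ d ∧ Related S i' g) ∧
        ∀ d, E d (j ⟨_, c.domain_mem hV hM'⟩) → ∃ c₁ g, E c₁ (j ⟨_, c.domain_mem hV hM⟩) ∧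
          (∀ q, E q f → E q g) ∧ Related g c₁ d ∧ Related S i' g := by
    rintro i f hi hiinf ⟨p, hp, hpS⟩
    obtain ⟨i₁, f₁, hp₁, hiso, hext⟩ := hS p hpS
    obtain ⟨rfl, rfl⟩ := target_isPair_inj hV hZ j hp hp₁
    refine ⟨hiso, ?_⟩
    rcases target_natural_cases hV hZ j hi with h | ⟨i', hi', h⟩
    · exact absurd (Set.eq_empty_of_forall_notMem h ▸ Set.finite_empty) hiinf
    · refine ⟨i', hi', fun hfin => hiinf ?_, hext i' h⟩
      exact (hfin.insert i').subset fun r hr => ((h r).1 hr).symm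
  refine ⟨?_, ?_, ?_⟩
  · rintro _ ⟨i, f, hi, hiinf, hif, rfl⟩
    exact isPartialIso_jRel c hV hZ j hL hM hM' hn hinf (key i f hi hiinf hif).1
  · rintro _ ⟨i, f, hi, hiinf, hif, rfl⟩ x
    obtain ⟨-, i', hi', hinf', h, -⟩ := key i f hi hiinf hif
    obtain ⟨d, g, hd, hfg, hxd, hg⟩ := h x.1 x.2
    refine ⟨⟨d, hd⟩, _, ⟨i', g, hi', hinf', hg, rfl⟩, ?_, hxd⟩
    rintro p ⟨q, hq, hqf⟩
    exact ⟨q, hq, hfg q hqf⟩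
  · rintro _ ⟨i, f, hi, hiinf, hif, rfl⟩ y
    obtain ⟨-, i', hi', hinf', -, h⟩ := key i f hi hiinf hif
    obtain ⟨d, g, hd, hfg, hxd, hg⟩ := h y.1 y.2
    refine ⟨⟨d, hd⟩, _, ⟨i', g, hi', hinf', hg, rfl⟩, ?_, hxd⟩
    rintro p ⟨q, hq, hqf⟩
    exact ⟨q, hq, hfg q hqf⟩

include hZ hL in
/-- The parameters in `A` belong to an internally finite set `X`. For nonstandard `n` there is a
game system with a position `f` which covers `X`, has `n` remaining moves, and takes values in an
internally finite set `Y`; so the image of `A` is again pseudofinite. -/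
theorem IsPseudosaturated.of_elementarilyEquivalent [Nonempty D] [Nonempty D'] (hDD : D ≅[L] D')
    (hW : IsOmegaNonstandard W) {κ : Cardinal.{w}} (h : IsPseudosaturated κ c hV j hM') :
    IsPseudosaturated κ c hV j hM := by
  rintro A ⟨X, hX, hAX⟩ hA
  obtain ⟨n, hn, hinf⟩ := hW
  have hsys := (transfer j (h := DefPair.hasGameSystems j _ _ _ _ _)).1
    (hasGameSystems_of_elementarilyEquivalent c hV hZ hL hM hM' hDD)
  obtain ⟨S, f, Y, hS, hSf, hY, hfX, hfY⟩ := hsys n X hn hX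
  choose t ht hxt using fun x : A => hfX x.1.1 (hAX _ ⟨_, x.2, rfl⟩) x.1.2
  refine (isBackAndForth_jSystem c hV hZ j hL hM hM' hn hinf hS).realizesTypesOver
    (h := fun x => ⟨t x, ht x⟩) ⟨n, f, hn, hinf, hSf, rfl⟩ hxt (h _ ⟨Y, hY, ?_⟩ ?_)
  · rintro _ ⟨_, ⟨x, rfl⟩, rfl⟩
    exact hfY _ _ (hxt x)
  · exact mk_range_le.trans_lt hA

omit [L.Structure D'] in
theorem isSaturated_iff_isPseudosaturated [Nonempty D] {κ : Cardinal.{w}}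
    (h : ∀ X : Set W, #X < κ → IsPseudofinite X) :
    IsSaturated L κ (JStd c hV j hM) ↔ IsPseudosaturated κ c hV j hM :=
  ⟨fun hs A _ hA => hs A hA, fun hs A hA => hs A (h _ (mk_image_le.trans_lt hA)) hA⟩

end JStd

/-! ### Regular ultrapowers of transitive models -/

section UltrapowerZF

variable {I : Type v} {U : Ultrafilter I} {V : Set ZFSet.{u}} (hV : IsTransitiveClass V)
  (hZ : ModelsZFCMinus V)

theorem E_mk_iff {s t : I → V} :
    E (Quotient.mk'' s : Ultrapower U V) (Quotient.mk'' t) ↔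
      ∀ᶠ i in (U : Filter I), E (s i) (t i) := by
  have h₁ : (fun k => (Quotient.mk'' ((![s, t] : Fin 2 → I → V) k) : Ultrapower U V)) =
      ![Quotient.mk'' s, Quotient.mk'' t] := by
    funext k
    refine Fin.cases rfl (fun k => Fin.cases rfl (fun k => k.elim0) k) k
  have h₂ : ∀ i, (fun k => (![s, t] : Fin 2 → I → V) k i) = ![s i, t i] := by
    intro i
    funext k
    refine Fin.cases rfl (fun k => Fin.cases rfl (fun k => k.elim0) k) k
  have := relMap_mk_iff (U := U) memSym ![s, t]
  simp only [h₁, h₂] at this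
  exact this

include hV hZ

/-- A function to `ω` which tends to infinity along the ultrafilter represents a nonstandard number.
-/
theorem isOmegaNonstandard_ultrapower [Infinite I] (hU : IsRegularUltrafilter U) :
    IsOmegaNonstandard (Ultrapower U V) := by
  have := hZ.nonempty
  obtain ⟨n, hn⟩ := hU.exists_tendsto
  let N : I → V := fun i => ⟨_, numeral_mem hV hZ (n i)⟩
  let j := losEmbedding U setLang V hZ.nonempty
  refine ⟨Quotient.mk'' N, (ultrapower_iff U j (fun _ => rfl) (P := IsNatural) inferInstance N).2
    (.of_forall fun i => (isNatural_iff hV hZ).2 ⟨_, rfl⟩), ?_⟩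
  refine Set.infinite_of_injective_forall_mem (f := fun k : ℕ => j ⟨_, numeral_mem hV hZ k⟩)
    (fun k l hkl => ?_) fun k => ?_
  · exact numeral_injective (congrArg Subtype.val (j.injective hkl))
  · change E (Quotient.mk'' fun _ => (⟨_, numeral_mem hV hZ k⟩ : V) : Ultrapower U V)
      (Quotient.mk'' N)
    refine E_mk_iff.2 ((hn.eventually_gt_atTop k).mono fun i hi => ?_)
    exact numeral_mem_numeral_iff.2 hi

/-- The finite approximations to `X` given by regularity, evaluated at the respective index,
represent an internally finite set which covers `X`. -/
theorem isPseudofinite_ultrapower (hU : IsRegularUltrafilter U) {X : Set (Ultrapower U V)}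
    (hX : #X < Order.succ (lift.{u + 1} #I)) : IsPseudofinite X := by
  have := hZ.nonempty
  rw [Order.lt_succ_iff] at hX
  obtain ⟨F, hF, hFX⟩ := hU.exists_finite_cover (X := X) (by simpa using lift_le.{v}.2 hX)
  have : ∀ i, ∃ s : V, IsInternallyFinite s ∧ ∀ r ∈ F i, E (Quotient.out r.1 i) s := by
    intro i
    have hfin := (hF i).image fun r : X => (Quotient.out r.1 i).1
    obtain ⟨s, hs, h⟩ := exists_mem_iff_of_finite hV hZ hfin (by
      rintro _ ⟨r, -, rfl⟩
      exact (Quotient.out r.1 i).2)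
    exact ⟨⟨s, hs⟩, (isInternallyFinite_iff hV hZ).2 (hfin.subset fun r hr => (h r).1 hr),
      fun r hr => (h _).2 ⟨r, hr, rfl⟩⟩
  choose s hs hsF using this
  refine ⟨Quotient.mk'' s, (ultrapower_iff U (losEmbedding U setLang V hZ.nonempty) (fun _ => rfl)
    (P := IsInternallyFinite) inferInstance s).2 (.of_forall hs), fun r hr => ?_⟩
  rw [← Quotient.out_eq' r]
  exact E_mk_iff.2 ((hFX ⟨r, hr⟩).mono fun i hi => hsF i _ hi)

end UltrapowerZF

end Pseudosat

theorem mainTheorem6 {L : FirstOrder.Language.{a, b}} [Countable L.Symbols] (T : L.Theory)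
    (hT : T.IsComplete) :
    -- models of `T` in a transitive model `V` of `ZFC⁻`
    (∀ (c : SymbolCoding.{u} L) (V : Set ZFSet.{u}) (hV : IsTransitiveClass V)
        (hZ : ModelsZFCMinus V), c.theoryCode T ∈ V →
      ∀ (M₀ M₁ : ZFSet.{u}) [Nonempty M₀] [Nonempty M₁] [L.Structure M₀] [L.Structure M₁]
        [M₀ ⊨ T] [M₁ ⊨ T] (h₀ : c.structureCode M₀ ∈ V) (h₁ : c.structureCode M₁ ∈ V),
        (∀ (W : Type w) [setLang.Structure W] (j : V ↪ₑ[setLang] W), IsOmegaNonstandard W →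
          ∀ κ : Cardinal.{w}, ℵ₀ < κ →
            (IsPseudosaturated κ c hV j h₀ ↔ IsPseudosaturated κ c hV j h₁) ∧
            ((∀ X : Set W, #X < κ → IsPseudofinite X) →
              (IsSaturated L κ (JStd c hV j h₀) ↔ IsSaturated L κ (JStd c hV j h₁)))) ∧
        -- the case of the ultrapower of `V` by a regular ultrafilter
        (∀ (I : Type v) [Infinite I] (U : Ultrafilter I), IsRegularUltrafilter U →
          IsOmegaNonstandard (Ultrapower U V) ∧
          (∀ X : Set (Ultrapower U V), #X < Order.succ (lift.{u + 1} #I) → IsPseudofinite X) ∧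
          (IsSaturated L (Order.succ (lift.{u + 1} #I))
              (JStd c hV (losEmbedding U setLang V hZ.nonempty) h₀) ↔
            IsSaturated L (Order.succ (lift.{u + 1} #I))
              (JStd c hV (losEmbedding U setLang V hZ.nonempty) h₁)))) ∧
    -- ultrapowers of arbitrary models of `T`
    (∀ (M₀ : Type x) (M₁ : Type y) [Nonempty M₀] [Nonempty M₁] [L.Structure M₀] [L.Structure M₁]
        [M₀ ⊨ T] [M₁ ⊨ T] (I : Type v) [Infinite I] (U : Ultrafilter I),
      IsRegularUltrafilter U →
        (IsSaturated L (Order.succ (lift.{x} #I)) (Ultrapower U M₀) ↔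
          IsSaturated L (Order.succ (lift.{y} #I)) (Ultrapower U M₁))) := by
  refine ⟨?_, ?_⟩
  · intro c V hV hZ hTV M₀ M₁ _ _ _ _ _ _ h₀ h₁
    have hL := c.languageCode_mem hV hTV
    have h₀₁ : M₀ ≅[L] M₁ := hT.models_elementarily_equivalent M₀ M₁
    have h₁₀ : M₁ ≅[L] M₀ := hT.models_elementarily_equivalent M₁ M₀
    refine ⟨fun W _ j hW κ _ => ?_, fun I _ U hU => ?_⟩
    · have hps : IsPseudosaturated κ c hV j h₀ ↔ IsPseudosaturated κ c hV j h₁ :=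
        ⟨fun h => h.of_elementarilyEquivalent c hV hZ j hL h₁ h₀ h₁₀ hW,
          fun h => h.of_elementarilyEquivalent c hV hZ j hL h₀ h₁ h₀₁ hW⟩
      refine ⟨hps, fun hX => ?_⟩
      rw [isSaturated_iff_isPseudosaturated c hV j h₀ hX,
        isSaturated_iff_isPseudosaturated c hV j h₁ hX, hps]
    · have hW := isOmegaNonstandard_ultrapower hV hZ hU
      have hX := fun X => isPseudofinite_ultrapower hV hZ hU (X := X)
      refine ⟨hW, hX, ?_⟩
      rw [isSaturated_iff_isPseudosaturated c hV _ h₀ hX,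
        isSaturated_iff_isPseudosaturated c hV _ h₁ hX]
      exact ⟨fun h => h.of_elementarilyEquivalent c hV hZ _ hL h₁ h₀ h₁₀ hW,
        fun h => h.of_elementarilyEquivalent c hV hZ _ hL h₀ h₁ h₀₁ hW⟩
  · intro M₀ M₁ _ _ _ _ _ _ I _ U hU
    exact ⟨fun h => h.ultrapower_of_elementarilyEquivalent hU
        (hT.models_elementarily_equivalent M₁ M₀),
      fun h => h.ultrapower_of_elementarilyEquivalent hU
        (hT.models_elementarily_equivalent M₀ M₁)⟩
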